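/- **Definitions.** For a metric space $(X,d)$, a set $A\subseteq X$ and $n\ge 0$, let $e_n(A):=\inf_{|S|<2^{2^n}}\sup_{x\in A}d(x,S)$, where the infimum is over finite sets $S\subseteq X$ (not required to lie in $A$). An admissible sequence of $T\subseteq X$ is an increasing sequence $(\mathcal A_n)_{n\ge 0}$ of partitions of $T$ (each refining the previous one) with $|\mathcal A_n|<2^{2^n}$ for all $n\ge 0$; for $x\in T$, $A_n(x)$ denotes the element of $\mathcal A_n$ that contains $x$. For $\alpha>0$ let $$\gamma_\alpha(T):=\inf_{(\mathcal A_n)}\ \sup_{x\in T}\ \sum_{n\ge 0}2^{n/\alpha}\operatorname{diam}(A_n(x)),$$ the infimum being over all admissible sequences of $T$. All these quantities take values in $[0,\infty]$. A set $T$ in a Banach lattice $X$ is solid if $x\in T$ and $|y|\le|x|$ imply $y\in T$. Its gauge is $\|x\|_T:=\inf\{s\ge 0: x\in sT\}\in[0,\infty]$, with $\inf\emptyset=\infty$. For $q\ge 1$, $T$ satisfies a lower $q$-estimate with constant $M\in[0,\infty)$ if $$\Big[\sum_{i=1}^n\|x_i\|_T^q\Big]^{1/q}\le M\,\Big\|\sum_{i=1}^n|x_i|\Big\|_T\qquad\text{for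 all } n\ge 1 \text{ and } x_1,\dots,x_n\in X .$$ A basis $b_1,\dots,b_d$ of a real normed space is called $1$-unconditional if $\|\sum_i\varepsilon_ic_ib_i\|=\|\sum_ic_ib_i\|$ for all real $c_i$ and all signs $\varepsilon_i\in\{-1,1\}$. **Theorem.** For every $\alpha>0$ there is a constant $C<\infty$, depending only on $\alpha$, such that the following hold. 1. Let $X$ be a Banach lattice, $T\subseteq X$ a solid compact convex set, $q\ge 1$ and $M\ge 0$. If $T$ satisfies a lower $q$-estimate with constant $M$, then, with distances taken in the norm of $X$, $$\gamma_\alpha(T)\le C\,M\Big[\sum_{n\ge 0}\big(2^{n/\alpha}e_n(T)\big)^{q/(q-1)}\Big]^{(q-1)/q}\quad\text{if } q>1,$$ $$\gamma_\alpha(T)\le C\,M\,\sup_{n\ge 0}2^{n/\alpha}e_n(T)\quad\text{if } q=1.$$ 2. Let $X$ be a $d$-dimensional real normed space with a $1$-unconditional basis $b_1,\dots,b_d$ (that is, $\mathbb R^d$ with a norm that is $1$-unconditional with respect to the standard basis), and let $B_1^d=\{\sum_ic_ib_i:\sum_i|c_i|\le 1\}$ be the unit $\ell_1$-ball. Then,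 with distances taken in the norm of $X$, Sudakov's lower bound is sharp: $$\sup_{n\ge 0}2^{n/\alpha}e_n(B_1^d)\ \le\ \gamma_\alpha(B_1^d)\ \le\ C\,\sup_{n\ge 0}2^{n/\alpha}e_n(B_1^d).$$ -/

import Mathlib

open scoped ENNReal NNReal Pointwise

/-- The `n`-th entropy number
`e_n(A) = inf_{|S| < 2^(2^n)} sup_{x ∈ A} d(x, S)`, valued in `[0, ∞]`. The nets `S` are finite
subsets of the ambient space and need not be contained in `A`; `d(x, ∅) = ∞`. -/
noncomputable def entropyNumber {X : Type*} [PseudoEMetricSpace X] (n : ℕ) (A : Set X) : ℝ≥0∞ :=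
  ⨅ (S : Finset X) (_ : S.card < 2 ^ 2 ^ n), ⨆ x ∈ A, Metric.infEDist x (S : Set X)

/-- An admissible sequence of `T`: an increasing (each one refines its predecessor) sequence of
partitions of `T` such that the `n`-th one has fewer than `2^(2^n)` elements. -/
structure AdmissibleSequence {X : Type*} (T : Set X) where
  /-- The elements of the `n`-th partition. -/
  parts : ℕ → Set (Set X)
  subset_of_mem : ∀ n, ∀ A ∈ parts n, A ⊆ T
  nonempty_of_mem : ∀ n, ∀ A ∈ parts n, A.Nonempty
  existsUnique_mem : ∀ n, ∀ x ∈ T, ∃! A, A ∈ parts n ∧ x ∈ A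
  refines : ∀ n, ∀ A ∈ parts (n + 1), ∃ B ∈ parts n, A ⊆ B
  card_lt : ∀ n, (parts n).encard < ((2 ^ 2 ^ n : ℕ) : ℕ∞)

/-- `A_n(x)`: for `x ∈ T`, the unique element of the `n`-th partition that contains `x`
(written as the union of the one-element family of all such partition elements). -/
def AdmissibleSequence.cell {X : Type*} {T : Set X} (𝒜 : AdmissibleSequence T) (n : ℕ) (x : X) :
    Set X :=
  ⋃₀ {A | A ∈ 𝒜.parts n ∧ x ∈ A}

/-- The chaining functional
`γ_α(T) = inf sup_{x ∈ T} ∑_{n ≥ 0} 2^(n/α) diam (A_n(x))`, valued in `[0, ∞]`, where the infimum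
is over all admissible sequences of `T`. -/
noncomputable def chainingFunctional {X : Type*} [PseudoEMetricSpace X] (α : ℝ) (T : Set X) :
    ℝ≥0∞ :=
  ⨅ 𝒜 : AdmissibleSequence T, ⨆ x ∈ T,
    ∑' n : ℕ, (2 : ℝ≥0∞) ^ ((n : ℝ) / α) * Metric.ediam (𝒜.cell n x)

/-- `T` satisfies a lower `q`-estimate with constant `M`:
`(∑ ‖x_i‖_T ^ q)^(1/q) ≤ M ‖∑ |x_i|‖_T` for all finite families of vectors, where
`‖x‖_T = inf {s ≥ 0 : x ∈ s T}` is the gauge of `T` (`egauge ℝ≥0 T`), which is `∞` at the vectors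
that lie in no multiple of `T`. -/
def HasLowerEstimate {X : Type*} [NormedAddCommGroup X] [NormedSpace ℝ X] [Lattice X]
    (T : Set X) (q : ℝ) (M : ℝ≥0) : Prop :=
  ∀ n : ℕ, 1 ≤ n → ∀ x : Fin n → X,
    (∑ i, egauge ℝ≥0 T (x i) ^ q) ^ (1 / q) ≤ (M : ℝ≥0∞) * egauge ℝ≥0 T (∑ i, |x i|)

/-- The norm of `X` is (`1`-)unconditional with respect to the basis `b`: changing the signs of the
coordinates of a vector does not change its norm. -/
def IsUnconditionalBasis {d : ℕ} {X : Type*} [NormedAddCommGroup X] [NormedSpace ℝ X]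
    (b : Module.Basis (Fin d) ℝ X) : Prop :=
  ∀ ε : Fin d → ℝ, (∀ i, ε i = 1 ∨ ε i = -1) → ∀ c : Fin d → ℝ,
    ‖∑ i, (ε i * c i) • b i‖ = ‖∑ i, c i • b i‖

/-- The unit `ℓ₁`-ball in the coordinates of the basis `b`. -/
def l1Ball {d : ℕ} {X : Type*} [NormedAddCommGroup X] [NormedSpace ℝ X]
    (b : Module.Basis (Fin d) ℝ X) : Set X :=
  {x | ∑ i, |b.repr x i| ≤ 1}

/-!
The chaining functional is bounded by a contraction principle combined with real interpolation.

Contraction principle (`chainingFunctional_le_of_entropyNumber_le`): if all `A ⊆ T` satisfy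
`e_n(A) ≤ b diam A + sup_A s_n` with `b` small enough in terms of `α`, then
`γ_α(T) ≲ diam T + sup_x ∑ 2^(n/α) s_n(x)`. A sequence of partitions is defined by refining the
cells at time `n + 1` according to a net of the cells at time `n`, on each of `n + 1` dyadic levels
of `s_n`. Its weighted diameters reproduce themselves with a factor at most `1/2`, which can be
absorbed in every partial sum.

Interpolation (`exists_near_minimizers`): for a functional `f` bounded on `T` and `t_n = c 2^(n/α)`,
let `π_n(x)` nearly minimize `y ↦ f(y) + t_n ‖x - y‖`. Then `∑ t_n ‖x - π_n(x)‖ ≲ sup_T f`.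

Lower estimate: let `f(y)` be the supremum of `∑ ‖x_i‖_T^q` over `∑ |x_i| ≤ |y|`. The lower
`q`-estimate says `f ≤ M^q` on `T`, and `f` is superadditive:
`f(w) + ‖y - w‖_T^q ≤ f(y)` whenever `|w| + |y - w| ≤ |y|`. With `w = y⁺ ⊓ z⁺ - y⁻ ⊓ z⁻`, the common
part of two near-minimizers `y` and `z`, minimality gives `‖y - w‖_T^q ≲ t_n ‖y - z‖`
(`egauge_sub_commonPart_rpow_le`). Hence the near-minimizers of the points of `A` lie in a translate
of `2r T` with `r^q` about `t_n diam A`, and `e_n(A)` is at most about `(t_n diam A)^(1/q) e_n(T)`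
(`entropyNumber_le_of_near_minimizers`). Young's inequality splits this into `b diam A` and a
multiple of `(2^(n/α))^(1/(q-1)) e_n(T)^(q/(q-1))`; for `q = 1` the second part is not needed.
Optimizing over `c` gives the first assertion.

An unconditional norm makes the coordinatewise order of the basis a Banach lattice order, and the
`ℓ₁`-ball satisfies a lower `1`-estimate with constant `1`, so the upper bound in the second
assertion is the case `q = 1` of the first. Sudakov's lower bound holds for every set
(`two_rpow_mul_entropyNumber_le_chainingFunctional`).
-/

/-! ### Chaining and the contraction principle -/

section Chaining

variable {X : Type*}

/-- Integer labels `l n`, each determined by the next one and taking fewer than `2 ^ 2 ^ n`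
values, encode an admissible sequence: the cells are the fibres of `l n` in `T`. -/
theorem chainingFunctional_le_of_label [PseudoEMetricSpace X] {α : ℝ} {T : Set X}
    (l : ℕ → X → ℕ) (hcard : ∀ n x, l n x + 1 < 2 ^ 2 ^ n)
    (href : ∀ n x y, l (n + 1) x = l (n + 1) y → l n x = l n y) {K : ℝ≥0∞}
    (hK : ∀ x ∈ T, ∑' n : ℕ, (2 : ℝ≥0∞) ^ ((n : ℝ) / α) *
      Metric.ediam {y ∈ T | l n y = l n x} ≤ K) :
    chainingFunctional α T ≤ K := by
  have key : ∀ n, ∀ x ∈ T, ∀ A, (A ∈ (fun x => {y ∈ T | l n y = l n x}) '' T ∧ x ∈ A) ↔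
      A = {y ∈ T | l n y = l n x} := by
    intro n x hx A
    constructor
    · rintro ⟨⟨z, hz, rfl⟩, hxz⟩
      ext y
      simp only [Set.mem_ofPred_eq] at hxz ⊢
      rw [hxz.2]
    · rintro rfl
      exact ⟨⟨x, hx, rfl⟩, hx, rfl⟩
  let 𝒜 : AdmissibleSequence T :=
    { parts := fun n => (fun x => {y ∈ T | l n y = l n x}) '' T
      subset_of_mem := by
        rintro n _ ⟨x, hx, rfl⟩ y hy
        exact hy.1
      nonempty_of_mem := by
        rintro n _ ⟨x, hx, rfl⟩
        exact ⟨x, hx, rfl⟩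
      existsUnique_mem := by
        intro n x hx
        exact ⟨_, (key n x hx _).2 rfl, fun A hA => (key n x hx A).1 hA⟩
      refines := by
        rintro n _ ⟨x, hx, rfl⟩
        exact ⟨_, ⟨x, hx, rfl⟩, fun y hy => ⟨hy.1, href n y x hy.2⟩⟩
      card_lt := by
        intro n
        have h1 : (fun x => {y ∈ T | l n y = l n x}) '' T
            = (fun c => {y ∈ T | l n y = c}) '' (l n '' T) := by
          rw [Set.image_image]
        have h2 : l n '' T ⊆ (Finset.range (2 ^ 2 ^ n - 1) : Set ℕ) := by
          rintro _ ⟨x, -, rfl⟩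
          have := hcard n x
          simp only [Finset.coe_range, Set.mem_Iio]
          omega
        rw [h1]
        refine ((Set.encard_image_le _ _).trans (Set.encard_le_encard h2)).trans_lt ?_
        rw [Set.encard_coe_eq_coe_finsetCard, Finset.card_range]
        have : 0 < 2 ^ 2 ^ n := by positivity
        exact_mod_cast (by omega : 2 ^ 2 ^ n - 1 < 2 ^ 2 ^ n) }
  have hcell : ∀ n, ∀ x ∈ T, 𝒜.cell n x = {y ∈ T | l n y = l n x} := by
    intro n x hx
    have : {A | A ∈ 𝒜.parts n ∧ x ∈ A} = {{y ∈ T | l n y = l n x}} := by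
      ext A
      exact key n x hx A
    rw [AdmissibleSequence.cell, this, Set.sUnion_singleton]
  refine (iInf_le _ 𝒜).trans (iSup₂_le fun x hx => ?_)
  simp only [hcell _ x hx]
  exact hK x hx

theorem entropyNumber_empty [PseudoEMetricSpace X] (n : ℕ) : entropyNumber n (∅ : Set X) = 0 :=
  le_antisymm (iInf₂_le_of_le ∅ (by simp) (by simp)) zero_le

theorem chainingFunctional_eq_zero [PseudoEMetricSpace X] {α : ℝ} {T : Set X}
    (hT : Metric.ediam T = 0) : chainingFunctional α T = 0 := by
  refine le_antisymm (chainingFunctional_le_of_label (fun _ _ => 0) ?_ (fun _ _ _ _ => rfl) ?_)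
    zero_le
  · intro n x
    exact Nat.one_lt_two_pow (by positivity)
  · intro x hx
    simp [hT]

/-- Indexing the points of `A` by a near-optimal net splits `A` into pieces of diameter about
`2 * entropyNumber n A`. The indices stay strictly below `2 ^ 2 ^ n - 1`, so that for `n = 0` there
is only one of them. -/
theorem exists_index_edist_le [PseudoEMetricSpace X] (n : ℕ) (A : Set X) {ε : ℝ≥0∞}
    (hε : ε ≠ 0) :
    ∃ j : X → ℕ, (∀ x, j x + 1 < 2 ^ 2 ^ n) ∧
      ∀ x ∈ A, ∀ y ∈ A, j x = j y → edist x y ≤ 2 * (entropyNumber n A + ε) := by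
  have hone : 1 < 2 ^ 2 ^ n := Nat.one_lt_two_pow (by positivity)
  by_cases he : entropyNumber n A = ∞
  · exact ⟨fun _ => 0, fun _ => hone, by simp [he]⟩
  have hlt : entropyNumber n A < entropyNumber n A + ε := ENNReal.lt_add_right he hε
  obtain ⟨S, hS⟩ := iInf_lt_iff.1 (hlt.trans_le' (le_refl
    (⨅ (S : Finset X) (_ : S.card < 2 ^ 2 ^ n), ⨆ x ∈ A, Metric.infEDist x (S : Set X))))
  obtain ⟨hcard, hS⟩ := iInf_lt_iff.1 hS
  have hnear : ∀ x, x ∈ A → ∃ p : S, edist x p < entropyNumber n A + ε := by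
    intro x hx
    obtain ⟨p, hp, h⟩ := Metric.infEDist_lt_iff.1 ((le_iSup₂ (f := fun x (_ : x ∈ A) =>
      Metric.infEDist x (S : Set X)) x hx).trans_lt hS)
    exact ⟨⟨p, hp⟩, h⟩
  choose p hp using hnear
  classical
  refine ⟨fun x => if h : x ∈ A then S.equivFin (p x h) else 0, fun x => ?_, ?_⟩
  · dsimp only
    split_ifs with h
    · have := (S.equivFin (p x h)).2
      omega
    · exact hone
  · intro x hx y hy hxy
    simp only [hx, hy, dif_pos] at hxy
    have hpq : p x hx = p y hy := S.equivFin.injective (Fin.ext hxy)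
    calc edist x y ≤ edist x (p x hx) + edist (p x hx : X) y := edist_triangle _ _ _
      _ ≤ (entropyNumber n A + ε) + (entropyNumber n A + ε) := by
          refine add_le_add (hp x hx).le ?_
          rw [hpq, edist_comm]
          exact (hp y hy).le
      _ = _ := (two_mul _).symm

theorem ediam_le_two_mul_entropyNumber_zero [PseudoEMetricSpace X] (A : Set X) :
    Metric.ediam A ≤ 2 * entropyNumber 0 A := by
  by_cases he : entropyNumber 0 A = ∞
  · simp [he]
  refine ENNReal.le_of_forall_pos_le_add fun ε hε _ => ?_
  obtain ⟨j, hj, h⟩ := exists_index_edist_le 0 A (ε := (ε / 2 : ℝ≥0)) (by positivity)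
  refine Metric.ediam_le fun x hx y hy => (h x hx y hy ?_).trans_eq ?_
  · have := hj x
    have := hj y
    simp at *
    omega
  · rw [mul_add]
    congr 1
    rw [← ENNReal.coe_ofNat, ← ENNReal.coe_mul, mul_div_cancel₀ _ two_ne_zero]

/-- A function bounded by `σ` is, on each of `n + 1` level sets, constant up to a factor `2` and an
error `σ / 2 ^ n`. -/
theorem exists_dyadic_level (n : ℕ) : ∀ (s : X → ℝ≥0∞) (σ : ℝ≥0∞), (∀ x, s x ≤ σ) →
    ∃ k : X → ℕ, (∀ x, k x ≤ n) ∧ ∀ x y, k x = k y → s y ≤ 2 * s x + σ / 2 ^ n := by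
  induction n with
  | zero =>
    intro s σ h
    exact ⟨fun _ => 0, fun _ => le_rfl, fun x y _ => (h y).trans (by simp)⟩
  | succ n ih =>
    intro s σ h
    obtain ⟨k, hk, hs⟩ := ih (fun x => min (s x) (σ / 2)) (σ / 2) fun _ => min_le_right _ _
    classical
    refine ⟨fun x => if σ / 2 < s x then n + 1 else k x, fun x => ?_, fun x y hxy => ?_⟩
    · dsimp only
      split_ifs
      · exact le_rfl
      · exact (hk x).trans n.le_succ
    · dsimp only at hxy
      have hkx := hk x
      have hky := hk y
      split_ifs at hxy with h1 h2 h2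
      · refine le_add_right ((h y).trans ?_)
        calc σ = 2 * (σ / 2) := (ENNReal.mul_div_cancel two_ne_zero ENNReal.ofNat_ne_top).symm
          _ ≤ 2 * s x := by gcongr
      · omega
      · omega
      · have := hs x y hxy
        rw [min_eq_left (not_lt.1 h2)] at this
        refine this.trans (add_le_add (by gcongr; exact min_le_left _ _) ?_)
        rw [pow_succ', ENNReal.div_eq_inv_mul, ENNReal.div_eq_inv_mul, ENNReal.div_eq_inv_mul,
          ENNReal.mul_inv (Or.inl two_ne_zero) (Or.inl ENNReal.ofNat_ne_top)]
        exact le_of_eq (by ring)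

theorem eq_and_eq_of_mul_add_eq {a a' c c' B : ℕ} (hc : c < B) (hc' : c' < B)
    (h : a * B + c = a' * B + c') : a = a' ∧ c = c' := by
  have hB : 0 < B := by omega
  have h1 := congrArg (· / B) h
  have h2 := congrArg (· % B) h
  simp only [mul_comm _ B, Nat.mul_add_div hB, Nat.div_eq_of_lt hc, Nat.div_eq_of_lt hc',
    Nat.mul_add_mod, Nat.mod_eq_of_lt hc, Nat.mod_eq_of_lt hc', add_zero] at h1 h2
  exact ⟨h1, h2⟩

/-- The labels of a sequence of partitions of `T` defined by self-reference: the cells at time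
`n + 2` are obtained from those at time `n + 1` by recording, in base `2 ^ 2 ^ n`, the level `k n x`
of `x` and its index `j n A x`, where `A` is the part of the cell of `x` at time `n` that has the
same level as `x`. -/
def refiningLabel (T : Set X) (k : ℕ → X → ℕ) (j : ℕ → Set X → X → ℕ) : ℕ → X → ℕ
  | 0 => fun _ => 0
  | 1 => fun _ => 0
  | n + 2 => fun x => refiningLabel T k j (n + 1) x * (2 ^ 2 ^ n * 2 ^ 2 ^ n) +
      (k n x * 2 ^ 2 ^ n + j n {y ∈ T | refiningLabel T k j n y = refiningLabel T k j n x ∧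
        k n y = k n x} x)

section refiningLabel

variable {T : Set X} {k : ℕ → X → ℕ} {j : ℕ → Set X → X → ℕ}

theorem level_mul_add_index_lt (hk : ∀ n x, k n x ≤ n)
    (hj : ∀ n A x, j n A x + 1 < 2 ^ 2 ^ n) (n : ℕ) (A : Set X) (x : X) :
    k n x * 2 ^ 2 ^ n + j n A x < 2 ^ 2 ^ n * 2 ^ 2 ^ n := by
  have h1 : k n x + 1 ≤ 2 ^ 2 ^ n := by
    have := hk n x
    have := n.lt_two_pow_self
    have := (2 ^ n).lt_two_pow_self
    omega
  have h2 := hj n A x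
  calc k n x * 2 ^ 2 ^ n + j n A x < k n x * 2 ^ 2 ^ n + 2 ^ 2 ^ n := by omega
    _ = (k n x + 1) * 2 ^ 2 ^ n := by ring
    _ ≤ _ := Nat.mul_le_mul_right _ h1

theorem refiningLabel_add_one_lt (hk : ∀ n x, k n x ≤ n)
    (hj : ∀ n A x, j n A x + 1 < 2 ^ 2 ^ n) (n : ℕ) (x : X) :
    refiningLabel T k j n x + 1 < 2 ^ 2 ^ n := by
  induction n with
  | zero => simp [refiningLabel]
  | succ n ih =>
    cases n with
    | zero => simp [refiningLabel]
    | succ n =>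
      have h := level_mul_add_index_lt hk hj n {y ∈ T | refiningLabel T k j n y =
        refiningLabel T k j n x ∧ k n y = k n x} x
      have e1 : 2 ^ 2 ^ (n + 1) = 2 ^ 2 ^ n * 2 ^ 2 ^ n := by
        rw [pow_succ 2 n, pow_mul]; ring
      have e2 : 2 ^ 2 ^ (n + 2) = (2 ^ 2 ^ n * 2 ^ 2 ^ n) * (2 ^ 2 ^ n * 2 ^ 2 ^ n) := by
        rw [pow_add 2 n, pow_mul]; ring
      rw [e1] at ih
      rw [e2]
      change _ * (2 ^ 2 ^ n * 2 ^ 2 ^ n) + (k n x * 2 ^ 2 ^ n + j n _ x) + 1 < _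
      have hone : 1 < 2 ^ 2 ^ n := Nat.one_lt_two_pow (by positivity)
      generalize k n x * 2 ^ 2 ^ n + j n _ x = c at h ⊢
      have hB : 1 < 2 ^ 2 ^ n * 2 ^ 2 ^ n := by nlinarith
      generalize 2 ^ 2 ^ n * 2 ^ 2 ^ n = B at *
      nlinarith

theorem refiningLabel_add_two_eq (hk : ∀ n x, k n x ≤ n)
    (hj : ∀ n A x, j n A x + 1 < 2 ^ 2 ^ n) {n : ℕ} {x y : X}
    (h : refiningLabel T k j (n + 2) x = refiningLabel T k j (n + 2) y) :
    refiningLabel T k j (n + 1) x = refiningLabel T k j (n + 1) y ∧ k n x = k n y ∧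
      j n {z ∈ T | refiningLabel T k j n z = refiningLabel T k j n x ∧ k n z = k n x} x =
      j n {z ∈ T | refiningLabel T k j n z = refiningLabel T k j n y ∧ k n z = k n y} y := by
  rw [refiningLabel] at h
  obtain ⟨h1, h2⟩ := eq_and_eq_of_mul_add_eq (level_mul_add_index_lt hk hj n _ x)
    (level_mul_add_index_lt hk hj n _ y) h
  exact ⟨h1, eq_and_eq_of_mul_add_eq ((Nat.lt_succ_self _).trans (hj n _ x))
    ((Nat.lt_succ_self _).trans (hj n _ y)) h2⟩

theorem refiningLabel_eq_of_succ_eq (hk : ∀ n x, k n x ≤ n)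
    (hj : ∀ n A x, j n A x + 1 < 2 ^ 2 ^ n) (n : ℕ) (x y : X)
    (h : refiningLabel T k j (n + 1) x = refiningLabel T k j (n + 1) y) :
    refiningLabel T k j n x = refiningLabel T k j n y := by
  cases n with
  | zero => rfl
  | succ n => exact (refiningLabel_add_two_eq hk hj h).1

end refiningLabel

theorem two_rpow_add (α : ℝ) (n m : ℕ) : (2 : ℝ≥0∞) ^ (((n + m : ℕ) : ℝ) / α) =
    2 ^ ((m : ℝ) / α) * 2 ^ ((n : ℝ) / α) := by
  rw [← ENNReal.rpow_add _ _ two_ne_zero ENNReal.ofNat_ne_top]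
  congr 1
  push_cast
  ring

theorem two_rpow_ne_zero (r : ℝ) : (2 : ℝ≥0∞) ^ r ≠ 0 := by
  simp [ENNReal.rpow_eq_zero_iff]

theorem two_rpow_ne_top (r : ℝ) : (2 : ℝ≥0∞) ^ r ≠ ∞ := by
  simp [ENNReal.rpow_eq_top_iff]

theorem sum_div_two_pow_le (S : ℝ≥0∞) (N : ℕ) :
    ∑ n ∈ Finset.range N, S / 2 ^ n ≤ 2 * S := by
  refine (ENNReal.sum_le_tsum _).trans_eq ?_
  simp_rw [div_eq_mul_inv, ENNReal.tsum_mul_left, ENNReal.inv_pow, ENNReal.tsum_geometric,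
    ENNReal.one_sub_inv_two, inv_inv, mul_comm]

/-- The contraction principle. If every `A ⊆ T` satisfies
`entropyNumber n A ≤ b * diam A + sup_A (s n)` with `b` small, then the chaining functional of `T`
is controlled by the sums `∑ 2 ^ (n / α) * s n x`. Since the partition at time `n + 2` is built by
covering the cells at time `n`, the weighted diameters satisfy a recursive inequality in which
`2 ^ (2 / α) * (2 * b) ≤ 1 / 2` makes the self-referring term absorbable; partial sums are bounded
by induction, so finiteness of the chaining functional need not be known beforehand. -/
theorem chainingFunctional_le_of_entropyNumber_le [PseudoEMetricSpace X] {α : ℝ}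
    {T : Set X} {s : ℕ → X → ℝ≥0∞} {b S : ℝ≥0∞} (hS0 : S ≠ 0)
    (hb : 2 ^ (2 / α) * (2 * b) ≤ 1 / 2)
    (hs : ∀ n, ∀ A ⊆ T, entropyNumber n A ≤ b * Metric.ediam A + ⨆ x ∈ A, s n x)
    (hS : ∀ x ∈ T, ∑' n : ℕ, 2 ^ ((n : ℝ) / α) * s n x ≤ S) :
    chainingFunctional α T ≤
      2 * ((1 + 2 ^ (1 / α)) * Metric.ediam T + 2 ^ (2 / α) * (12 * S)) := by
  rcases eq_or_ne S ∞ with rfl | hStop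
  · simp [ENNReal.mul_top]
  set w : ℕ → ℝ≥0∞ := fun n => 2 ^ ((n : ℝ) / α) with hw
  have hw0 : ∀ n, w n ≠ 0 := fun n => two_rpow_ne_zero _
  have hwt : ∀ n, w n ≠ ∞ := fun n => two_rpow_ne_top _
  set σ : ℕ → ℝ≥0∞ := fun n => S / w n with hσ
  have hwσ : ∀ n, w n * σ n = S := fun n => ENNReal.mul_div_cancel (hw0 n) (hwt n)
  have hsσ : ∀ n, ∀ x ∈ T, s n x ≤ σ n := by
    intro n x hx
    rw [hσ, ENNReal.le_div_iff_mul_le (Or.inl (hw0 n)) (Or.inl (hwt n)), mul_comm]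
    exact (ENNReal.le_tsum n).trans (hS x hx)
  have hlevel : ∀ n, ∃ k : X → ℕ, (∀ x, k x ≤ n) ∧
      ∀ x ∈ T, ∀ y ∈ T, k x = k y → s n y ≤ 2 * s n x + σ n / 2 ^ n := by
    intro n
    obtain ⟨k, hk, h⟩ := exists_dyadic_level n (fun x => min (s n x) (σ n)) (σ n)
      fun _ => min_le_right _ _
    refine ⟨k, hk, fun x hx y hy hxy => ?_⟩
    simpa only [min_eq_left (hsσ n x hx), min_eq_left (hsσ n y hy)] using h x y hxy
  choose k hk hks using hlevel
  -- The same summable error `σ n / 2 ^ n` also serves as the slack in the choice of the nets.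
  have hε : ∀ n, σ n / 2 ^ n ≠ 0 := fun n =>
    ENNReal.div_ne_zero.2 ⟨ENNReal.div_ne_zero.2 ⟨hS0, hwt n⟩, by simp⟩
  choose j hj hjd using fun n (A : Set X) => exists_index_edist_le n A (hε n)
  set l := refiningLabel T k j with hl
  set cell : ℕ → X → Set X := fun n x => {y ∈ T | l n y = l n x} with hcell
  have hstep : ∀ n, ∀ x ∈ T, w n * Metric.ediam (cell (n + 2) x) ≤
      2 * b * (w n * Metric.ediam (cell n x)) + (4 * (w n * s n x) + 4 * (S / 2 ^ n)) := by
    intro n x hx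
    set A : Set X := {y ∈ T | l n y = l n x ∧ k n y = k n x} with hA
    -- Points of the new cell share the old cell, the level of `s n`, and the nearest net point.
    have hd : Metric.ediam (cell (n + 2) x) ≤ 2 * (entropyNumber n A + σ n / 2 ^ n) := by
      have hmem : ∀ y ∈ cell (n + 2) x, y ∈ A ∧ j n A y = j n A x := by
        rintro y ⟨hyT, hy⟩
        obtain ⟨h1, h2, h3⟩ := refiningLabel_add_two_eq hk hj hy
        have h4 := refiningLabel_eq_of_succ_eq hk hj _ _ _ h1
        rw [h4, h2] at h3
        exact ⟨⟨hyT, h4, h2⟩, h3⟩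
      refine Metric.ediam_le fun y hy z hz => ?_
      exact hjd n A y (hmem y hy).1 z (hmem z hz).1 ((hmem y hy).2.trans (hmem z hz).2.symm)
    have he : entropyNumber n A ≤
        b * Metric.ediam (cell n x) + (2 * s n x + σ n / 2 ^ n) := by
      refine (hs n A fun y hy => hy.1).trans (add_le_add ?_ ?_)
      · gcongr
        exact fun y hy => ⟨hy.1, hy.2.1⟩
      · exact iSup₂_le fun y hy => hks n x hx y hy.1 hy.2.2.symm
    calc w n * Metric.ediam (cell (n + 2) x)
        ≤ w n * (2 * (b * Metric.ediam (cell n x) + (2 * s n x + σ n / 2 ^ n)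
            + σ n / 2 ^ n)) := by
          gcongr
          exact hd.trans (by gcongr)
      _ = 2 * b * (w n * Metric.ediam (cell n x)) + (4 * (w n * s n x) +
            4 * (w n * σ n / 2 ^ n)) := by
          simp only [div_eq_mul_inv]; ring
      _ = _ := by rw [hwσ]
  have hsum : ∀ x ∈ T, ∀ N, ∑ n ∈ Finset.range N, w n * Metric.ediam (cell n x) ≤
      2 * ((1 + 2 ^ (1 / α)) * Metric.ediam T + 2 ^ (2 / α) * (12 * S)) := by
    intro x hx
    set K := (1 + 2 ^ (1 / α)) * Metric.ediam T + 2 ^ (2 / α) * (12 * S)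
    have hcT : ∀ n, Metric.ediam (cell n x) ≤ Metric.ediam T := fun n =>
      Metric.ediam_mono fun y hy => hy.1
    have htwo : ∀ N, (∑ n ∈ Finset.range N, w n * Metric.ediam (cell n x) ≤ 2 * K) →
        ∑ n ∈ Finset.range (N + 2), w n * Metric.ediam (cell n x) ≤ 2 * K := by
      intro N ih
      rw [Finset.sum_range_succ', Finset.sum_range_succ', add_assoc]
      have h0 : w (0 + 1) * Metric.ediam (cell (0 + 1) x) + w 0 * Metric.ediam (cell 0 x) ≤
          (1 + 2 ^ (1 / α)) * Metric.ediam T := by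
        rw [add_comm, add_mul]
        simp only [hw]
        norm_num
        exact add_le_add (hcT 0) (mul_le_mul_right (hcT 1) _)
      have h1 : ∑ n ∈ Finset.range N, w (n + 1 + 1) * Metric.ediam (cell (n + 1 + 1) x) ≤
          K + 2 ^ (2 / α) * (12 * S) := by
        calc ∑ n ∈ Finset.range N, w (n + 1 + 1) * Metric.ediam (cell (n + 1 + 1) x)
            = 2 ^ (2 / α) * ∑ n ∈ Finset.range N, w n * Metric.ediam (cell (n + 2) x) := by
              rw [Finset.mul_sum]
              refine Finset.sum_congr rfl fun n _ => ?_
              rw [add_assoc, one_add_one_eq_two, ← mul_assoc]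
              congr 1
              exact_mod_cast two_rpow_add α n 2
          _ ≤ 2 ^ (2 / α) * ∑ n ∈ Finset.range N, (2 * b * (w n * Metric.ediam (cell n x)) +
                (4 * (w n * s n x) + 4 * (S / 2 ^ n))) := by
              gcongr with n
              exact hstep n x hx
          _ = 2 ^ (2 / α) * (2 * b) * ∑ n ∈ Finset.range N, w n * Metric.ediam (cell n x) +
                2 ^ (2 / α) * (4 * ∑ n ∈ Finset.range N, w n * s n x +
                4 * ∑ n ∈ Finset.range N, S / 2 ^ n) := by
              rw [Finset.sum_add_distrib, Finset.sum_add_distrib, ← Finset.mul_sum,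
                ← Finset.mul_sum, ← Finset.mul_sum]
              ring
          -- The induction hypothesis bounds the self-referring term by half of `2 * K`.
          _ ≤ 1 / 2 * (2 * K) + 2 ^ (2 / α) * (4 * S + 4 * (2 * S)) := by
              gcongr
              · exact (ENNReal.sum_le_tsum _).trans (hS x hx)
              · exact sum_div_two_pow_le S N
          _ = K + 2 ^ (2 / α) * (12 * S) := by
              rw [← mul_assoc, one_div, ENNReal.inv_mul_cancel two_ne_zero ENNReal.ofNat_ne_top,
                one_mul]
              ring
      calc _ ≤ (K + 2 ^ (2 / α) * (12 * S)) + (1 + 2 ^ (1 / α)) * Metric.ediam T :=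
            add_le_add h1 h0
        _ = 2 * K := by simp only [K]; ring
    intro N
    induction N using Nat.twoStepInduction with
    | zero => simp
    | one =>
      refine (htwo 0 (by simp)).trans' ?_
      gcongr
      norm_num
    | more N ih _ => exact htwo N ih
  refine chainingFunctional_le_of_label l (refiningLabel_add_one_lt hk hj)
    (refiningLabel_eq_of_succ_eq hk hj) fun x hx => ?_
  exact ENNReal.tsum_le_of_sum_range_le (hsum x hx)

end Chaining

/-! ### Interpolation and gauges in lattices -/

section Interpolation

variable {X : Type*} [PseudoEMetricSpace X]

/-- Interpolation. Let `K n x = inf_y (f y + t n * d(x, y))` with geometrically growing `t n`. The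
distances from `x` to near-minimizers `π n x` satisfy `∑ t n * d(x, π n x) ≲ f x`, because
`t n * d(x, π n x)` is dominated by the increments of `n ↦ K n x`, which sum to at most `f x`. The
errors `ε n` remove the need for exact minimizers. -/
theorem exists_near_minimizers {f : X → ℝ≥0∞} {t ε : ℕ → ℝ≥0∞} {κ : ℝ≥0∞} (hκ1 : κ ≤ 1)
    (hκ : ∀ n, t n + κ * t (n + 1) ≤ t (n + 1)) (hε : ∀ n, ε n ≠ 0) {T : Set X} {B : ℝ≥0∞}
    (hB : B ≠ ∞) (hf : ∀ x ∈ T, f x ≤ B) :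
    ∃ π : ℕ → X → X, ∀ x ∈ T,
      (∀ n y, f (π n x) + t n * edist x (π n x) ≤ f y + t n * edist x y + ε n) ∧
      κ * ∑' n, t n * edist x (π n x) ≤ B + ∑' n, ε n := by
  set K : ℕ → X → ℝ≥0∞ := fun n x => ⨅ y, f y + t n * edist x y with hK
  have hKB : ∀ n, ∀ x ∈ T, K n x ≤ B := fun n x hx =>
    (iInf_le _ x).trans (by simpa using hf x hx)
  have hex : ∀ n x, x ∈ T → ∃ y, f y + t n * edist x y < K n x + ε n := fun n x hx =>
    iInf_lt_iff.1 (ENNReal.lt_add_right ((hKB n x hx).trans_lt hB.lt_top).ne (hε n))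
  have hex' : ∀ n x, ∃ y, x ∈ T → f y + t n * edist x y < K n x + ε n := fun n x => by
    by_cases hx : x ∈ T
    · exact (hex n x hx).imp fun y hy _ => hy
    · exact ⟨x, fun h => absurd h hx⟩
  choose π hπ using hex'
  refine ⟨π, fun x hx => ⟨fun n y => (hπ n x hx).le.trans ?_, ?_⟩⟩
  · gcongr
    exact iInf_le _ y
  · have hpart : ∀ N, κ * ∑ n ∈ Finset.range (N + 1), t n * edist x (π n x) ≤
        K N x + ∑ n ∈ Finset.range (N + 1), ε n := by
      intro N
      induction N with
      | zero =>
        simp only [zero_add, Finset.sum_range_one]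
        refine (mul_le_of_le_one_left' hκ1).trans (le_trans ?_ (hπ 0 x hx).le)
        exact le_add_self
      | succ N ih =>
        rw [Finset.sum_range_succ, mul_add, Finset.sum_range_succ _ (N + 1)]
        set y := π (N + 1) x
        calc _ ≤ K N x + ∑ n ∈ Finset.range (N + 1), ε n + κ * (t (N + 1) * edist x y) := by
              gcongr
          _ ≤ (f y + t N * edist x y) + ∑ n ∈ Finset.range (N + 1), ε n +
                κ * (t (N + 1) * edist x y) := by
              gcongr
              exact iInf_le _ y
          _ = f y + (t N + κ * t (N + 1)) * edist x y + ∑ n ∈ Finset.range (N + 1), ε n := by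
              ring
          _ ≤ f y + t (N + 1) * edist x y + ∑ n ∈ Finset.range (N + 1), ε n := by
              gcongr
              exact hκ N
          _ ≤ (K (N + 1) x + ε (N + 1)) + ∑ n ∈ Finset.range (N + 1), ε n := by
              exact add_le_add (hπ (N + 1) x hx).le le_rfl
          _ = _ := by ring
    rw [← ENNReal.tsum_mul_left]
    refine ENNReal.tsum_le_of_sum_range_le fun N => ?_
    rw [← Finset.mul_sum]
    calc _ ≤ κ * ∑ n ∈ Finset.range (N + 1), t n * edist x (π n x) := by
          gcongr
          exact N.le_succ
      _ ≤ _ := hpart N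
      _ ≤ _ := add_le_add (hKB N x hx) (ENNReal.sum_le_tsum _)

end Interpolation

section LatticeOrderedGroup

variable {X : Type*} [AddCommGroup X] [Lattice X]

/-- The part that `y` and `z` have in common: in a function lattice, the one of `y` and `z` that is
smaller in absolute value where they have the same sign, and `0` elsewhere. -/
def commonPart (y z : X) : X := y⁺ ⊓ z⁺ - y⁻ ⊓ z⁻

theorem commonPart_comm (y z : X) : commonPart y z = commonPart z y := by
  rw [commonPart, commonPart, inf_comm, inf_comm y⁻]

variable [IsOrderedAddMonoid X]

theorem sub_commonPart (y z : X) :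
    y - commonPart y z = (y⁺ - y⁺ ⊓ z⁺) - (y⁻ - y⁻ ⊓ z⁻) := by
  nth_rw 1 [← posPart_sub_negPart y]
  rw [commonPart]
  abel

theorem abs_sub_le_add_of_nonneg {a b : X} (ha : 0 ≤ a) (hb : 0 ≤ b) : |a - b| ≤ a + b := by
  refine abs_le'.2 ⟨?_, ?_⟩
  · exact (sub_le_self a hb).trans (le_add_of_nonneg_right hb)
  · rw [neg_sub]
    exact (sub_le_self b ha).trans (le_add_of_nonneg_left ha)

/-- `y` decomposes without cancellation into the common part with `z` and the remainder. -/
theorem abs_commonPart_add_abs_sub_le (y z : X) :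
    |commonPart y z| + |y - commonPart y z| ≤ |y| := by
  have h1 : |commonPart y z| ≤ y⁺ ⊓ z⁺ + y⁻ ⊓ z⁻ :=
    abs_sub_le_add_of_nonneg (le_inf (posPart_nonneg _) (posPart_nonneg _))
      (le_inf (negPart_nonneg _) (negPart_nonneg _))
  have h2 : |y - commonPart y z| ≤ (y⁺ - y⁺ ⊓ z⁺) + (y⁻ - y⁻ ⊓ z⁻) := by
    rw [sub_commonPart]
    exact abs_sub_le_add_of_nonneg (sub_nonneg.2 inf_le_left) (sub_nonneg.2 inf_le_left)
  refine (add_le_add h1 h2).trans_eq ?_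
  rw [← posPart_add_negPart y]
  abel

theorem posPart_sub_inf_le (y z : X) : y⁺ - y⁺ ⊓ z⁺ ≤ (y - z)⁺ := by
  rw [sub_le_comm]
  refine le_inf (sub_le_self _ (posPart_nonneg _)) ?_
  rw [sub_le_iff_le_add]
  refine sup_le ?_ (add_nonneg (posPart_nonneg _) (posPart_nonneg _))
  calc y = z + (y - z) := by abel
    _ ≤ _ := add_le_add (le_posPart _) (le_posPart _)

theorem abs_sub_commonPart_le (y z : X) : |y - commonPart y z| ≤ |y - z| := by
  have h := posPart_sub_inf_le (-y) (-z)
  rw [posPart_neg, posPart_neg, neg_sub_neg, ← neg_sub y z, posPart_neg] at h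
  rw [sub_commonPart, ← posPart_add_negPart (y - z)]
  exact (abs_sub_le_add_of_nonneg (sub_nonneg.2 inf_le_left) (sub_nonneg.2 inf_le_left)).trans
    (add_le_add (posPart_sub_inf_le y z) h)

end LatticeOrderedGroup

section BanachLattice

variable {X : Type*} [NormedAddCommGroup X] [NormedSpace ℝ X]

/-- Nets of `T` are carried to nets of `A` when `A` lies within `δ` of `z + c • T`. -/
theorem entropyNumber_le_add_mul {n : ℕ} {A T : Set X} {δ : ℝ≥0∞} {c : ℝ≥0} (hc : c ≠ 0)
    (z : X) (h : ∀ x ∈ A, ∃ u ∈ T, edist x (z + c • u) ≤ δ) :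
    entropyNumber n A ≤ δ + c * entropyNumber n T := by
  classical
  have e : δ + c * entropyNumber n T = ⨅ (S : Finset X) (_ : S.card < 2 ^ 2 ^ n),
      (δ + c * ⨆ x ∈ T, Metric.infEDist x (S : Set X)) := by
    simp only [entropyNumber, ENNReal.mul_iInf_of_ne (ENNReal.coe_ne_zero.2 hc)
      ENNReal.coe_ne_top, ENNReal.add_iInf]
  rw [e]
  refine le_iInf₂ fun S hS => iInf₂_le_of_le (S.image fun u => z + c • u)
    (Finset.card_image_le.trans_lt hS) (iSup₂_le fun x hx => ?_)
  obtain ⟨u, hu, hxu⟩ := h x hx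
  refine Metric.infEDist_le_edist_add_infEDist.trans (add_le_add hxu ?_)
  refine le_trans ?_ (mul_le_mul_right (le_iSup₂ (f := fun x (_ : x ∈ T) =>
    Metric.infEDist x (S : Set X)) u hu) _)
  rw [Metric.infEDist, Metric.infEDist]
  simp only [ENNReal.mul_iInf_of_ne (ENNReal.coe_ne_zero.2 hc) ENNReal.coe_ne_top]
  refine le_iInf₂ fun p hp => iInf₂_le_of_le (z + c • p) ?_ ?_
  · exact Finset.mem_coe.2 (Finset.mem_image_of_mem _ hp)
  · rw [edist_add_left, NNReal.smul_def, NNReal.smul_def, edist_smul₀]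
    simp [ENNReal.smul_def]

theorem egauge_le_one_of_mem {T : Set X} {x : X} (hx : x ∈ T) : egauge ℝ≥0 T x ≤ 1 := by
  refine (egauge_le_of_mem_smul (c := (1 : ℝ≥0)) (by simpa using hx)).trans_eq ?_
  exact ENNReal.coe_one

variable [Lattice X]

/-- The largest value of `∑ ‖x i‖_T ^ q` over the finite families with `∑ |x i| ≤ |y|`. When `T`
satisfies a lower `q`-estimate this is comparable to `‖y‖_T ^ q`, and in contrast to the latter it
is superadditive without any constant. -/
noncomputable def lowerEstimateEnvelope (T : Set X) (q : ℝ) (y : X) : ℝ≥0∞ :=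
  ⨆ (n : ℕ) (x : Fin n → X) (_ : ∑ i, |x i| ≤ |y|), ∑ i, egauge ℝ≥0 T (x i) ^ q

variable [IsOrderedAddMonoid X]

theorem lowerEstimateEnvelope_le {T : Set X} {q : ℝ} {M : ℝ≥0} (hq : 1 ≤ q)
    (hsolid : LatticeOrderedAddCommGroup.IsSolid T) (hest : HasLowerEstimate T q M)
    {y : X} (hy : y ∈ T) : lowerEstimateEnvelope T q y ≤ (M : ℝ≥0∞) ^ q := by
  refine iSup_le fun n => iSup₂_le fun x hx => ?_
  rcases n.eq_zero_or_pos with rfl | hn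
  · simp
  have hmem : ∑ i, |x i| ∈ T := by
    refine hsolid hy ?_
    rwa [abs_of_nonneg (Finset.sum_nonneg fun i _ => abs_nonneg _)]
  have hq0 : 0 < q := by linarith
  have h := (hest n hn x).trans (mul_le_of_le_one_right' (egauge_le_one_of_mem hmem))
  rwa [one_div, ENNReal.rpow_inv_le_iff hq0] at h

theorem lowerEstimateEnvelope_add_le (T : Set X) (q : ℝ) {w v y : X} (h : |w| + |v| ≤ |y|) :
    lowerEstimateEnvelope T q w + egauge ℝ≥0 T v ^ q ≤ lowerEstimateEnvelope T q y := by
  have : Nonempty {p : (n : ℕ) × (Fin n → X) // ∑ i, |p.2 i| ≤ |w|} := ⟨⟨⟨0, Fin.elim0⟩, by simp⟩⟩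
  have e : lowerEstimateEnvelope T q w = ⨆ p : {p : (n : ℕ) × (Fin n → X) //
      ∑ i, |p.2 i| ≤ |w|}, ∑ i, egauge ℝ≥0 T (p.1.2 i) ^ q := by
    rw [iSup_subtype, iSup_sigma, lowerEstimateEnvelope]
  rw [e, ENNReal.iSup_add]
  refine iSup_le fun ⟨⟨n, x⟩, hx⟩ => ?_
  refine le_iSup_of_le (n + 1) (le_iSup₂_of_le (Fin.cons v x) ?_ ?_)
  · rw [Fin.sum_univ_succ]
    simp only [Fin.cons_zero, Fin.cons_succ]
    refine le_trans ?_ h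
    rw [add_comm]
    exact add_le_add hx le_rfl
  · rw [Fin.sum_univ_succ, add_comm]
    rfl

/-- If `y` nearly minimizes `v ↦ f v + t * d(x, v)`, where `f` is the superadditive envelope, then
comparison with `v = commonPart y z` shows that removing `y - commonPart y z` saves at least
`‖y - commonPart y z‖_T ^ q` in the first term and costs at most `t * d(y, z)` in the second. -/
theorem egauge_sub_commonPart_rpow_le [HasSolidNorm X] {T : Set X} {q : ℝ} {t ε : ℝ≥0∞}
    (ht : t ≠ ∞) {x y : X} (z : X) (hfin : lowerEstimateEnvelope T q y ≠ ∞)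
    (hmin : ∀ v, lowerEstimateEnvelope T q y + t * edist x y ≤
      lowerEstimateEnvelope T q v + t * edist x v + ε) :
    egauge ℝ≥0 T (y - commonPart y z) ^ q ≤ t * edist y z + ε := by
  set w := commonPart y z
  have h1 := lowerEstimateEnvelope_add_le T q (abs_commonPart_add_abs_sub_le y z)
  have hw : lowerEstimateEnvelope T q w ≠ ∞ := (lt_of_le_of_lt (le_self_add.trans h1)
    hfin.lt_top).ne
  have h2 : edist y w ≤ edist y z := by
    rw [edist_eq_enorm_sub, edist_eq_enorm_sub, enorm_le_iff_norm_le]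
    exact HasSolidNorm.solid (abs_sub_commonPart_le y z)
  have h3 : lowerEstimateEnvelope T q w + t * edist x y + egauge ℝ≥0 T (y - w) ^ q ≤
      lowerEstimateEnvelope T q w + t * edist x y + (t * edist y z + ε) := by
    calc _ = lowerEstimateEnvelope T q w + egauge ℝ≥0 T (y - w) ^ q + t * edist x y := by ring
      _ ≤ lowerEstimateEnvelope T q y + t * edist x y := by gcongr
      _ ≤ lowerEstimateEnvelope T q w + t * edist x w + ε := hmin w
      _ ≤ lowerEstimateEnvelope T q w + t * (edist x y + edist y z) + ε := by
          gcongr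
          exact (edist_triangle x y w).trans (by gcongr)
      _ = _ := by ring
  exact (ENNReal.add_le_add_iff_left
    (ENNReal.add_ne_top.2 ⟨hw, ENNReal.mul_ne_top ht (edist_ne_top _ _)⟩)).1 h3

/-- The scalars of `egauge ℝ≥0` are nonnegative; convexity and `0 ∈ T` allow enlarging them. -/
theorem exists_smul_eq_of_egauge_lt {T : Set X} (hconv : Convex ℝ T)
    (hsolid : LatticeOrderedAddCommGroup.IsSolid T) {v : X} {r : ℝ≥0}
    (h : egauge ℝ≥0 T v < r) : ∃ u ∈ T, v = r • u := by
  obtain ⟨c, hc, hcr⟩ : ∃ c : ℝ≥0, v ∈ c • T ∧ ‖c‖ₑ < r := by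
    simpa [egauge, iInf_lt_iff] using h
  obtain ⟨u, hu, rfl⟩ := hc
  have hcr' : c < r := ENNReal.coe_lt_coe.1 hcr
  have hr : r ≠ 0 := (zero_le.trans_lt hcr').ne'
  have h0 : (0 : X) ∈ T := hsolid hu (by simp)
  refine ⟨((c / r : ℝ≥0) : ℝ) • u, hconv.smul_mem_of_zero_mem h0 hu ⟨NNReal.coe_nonneg _, ?_⟩, ?_⟩
  · exact_mod_cast (div_le_one (pos_iff_ne_zero.2 hr)).2 hcr'.le
  · change c • u = _
    rw [← NNReal.smul_def, smul_smul, mul_div_cancel₀ _ hr]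

/-- Two points that are gauge-close to their common part differ by an element of `(2 * r) • T`. -/
theorem exists_eq_add_smul {T : Set X} (hconv : Convex ℝ T)
    (hsolid : LatticeOrderedAddCommGroup.IsSolid T) {y z : X} {r : ℝ≥0}
    (hy : egauge ℝ≥0 T (y - commonPart y z) < r) (hz : egauge ℝ≥0 T (z - commonPart z y) < r) :
    ∃ u ∈ T, y = z + (2 * r) • u := by
  obtain ⟨u, hu, hyu⟩ := exists_smul_eq_of_egauge_lt hconv hsolid hy
  obtain ⟨v, hv, hzv⟩ := exists_smul_eq_of_egauge_lt hconv hsolid hz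
  rw [commonPart_comm z y] at hzv
  refine ⟨(1 / 2 : ℝ) • u + (1 / 2 : ℝ) • (-v), hconv hu (hsolid hv (by simp)) (by norm_num)
    (by norm_num) (by norm_num), ?_⟩
  have : y = z + (r • u - r • v) := by rw [← hyu, ← hzv]; abel
  rw [this]
  simp only [NNReal.smul_def, smul_add, smul_neg, smul_smul]
  push_cast
  rw [show 2 * (r : ℝ) * (1 / 2) = r by ring]
  abel

end BanachLattice

/-! ### Entropy numbers under a lower estimate -/

section LowerEstimate

variable {X : Type*} [NormedAddCommGroup X] [NormedSpace ℝ X] [Lattice X] [IsOrderedAddMonoid X]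
  [HasSolidNorm X]

/-- The near-minimizers `π x` of the points `x` of `A` lie in a single translate of `2 * r • T`,
where `r ^ q` is `t` times their diameter up to the errors `σ`; so a net of `T` yields one of
`A`. -/
theorem entropyNumber_le_of_near_minimizers {T : Set X} (hconv : Convex ℝ T)
    (hsolid : LatticeOrderedAddCommGroup.IsSolid T) {q : ℝ} (hq : 1 ≤ q) {t ε : ℝ≥0∞}
    (ht0 : t ≠ 0) (ht : t ≠ ∞) (hε : ε ≠ 0) {A : Set X} {π : X → X}
    (hfin : ∀ x ∈ A, lowerEstimateEnvelope T q (π x) ≠ ∞)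
    (hmin : ∀ x ∈ A, ∀ v, lowerEstimateEnvelope T q (π x) + t * edist x (π x) ≤
      lowerEstimateEnvelope T q v + t * edist x v + ε)
    (hA : Metric.ediam A ≠ ∞) {σ : ℝ≥0∞} (hσ : ∀ x ∈ A, edist x (π x) + ε / t ≤ σ)
    (hσt : σ ≠ ∞) (n : ℕ) :
    entropyNumber n A ≤
      σ + 2 * (t * (Metric.ediam A + 2 * σ)) ^ (1 / q) * entropyNumber n T := by
  rcases A.eq_empty_or_nonempty with rfl | ⟨x₀, hx₀⟩
  · rw [entropyNumber_empty]
    exact zero_le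
  set Z : ℝ≥0∞ := t * (Metric.ediam A + 2 * σ) with hZ
  have hq0 : 0 < q := by linarith
  have hZt : Z ≠ ∞ := ENNReal.mul_ne_top ht
    (ENNReal.add_ne_top.2 ⟨hA, ENNReal.mul_ne_top ENNReal.ofNat_ne_top hσt⟩)
  have hlt : ∀ x ∈ A, ∀ y ∈ A, t * edist (π x) (π y) + ε < Z := by
    intro x hx y hy
    have h : t * edist (π x) (π y) + ε + ε ≤ Z := by
      have h1 : edist (π x) (π y) ≤ edist x (π x) + Metric.ediam A + edist y (π y) := by
        refine (edist_triangle4 (π x) x y (π y)).trans ?_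
        rw [edist_comm (π x) x]
        gcongr
        exact Metric.edist_le_ediam_of_mem hx hy
      calc t * edist (π x) (π y) + ε + ε
          ≤ t * (edist x (π x) + Metric.ediam A + edist y (π y)) + t * (ε / t) + t * (ε / t) := by
            rw [ENNReal.mul_div_cancel ht0 ht]
            gcongr
        _ = t * (Metric.ediam A + ((edist x (π x) + ε / t) + (edist y (π y) + ε / t))) := by ring
        _ ≤ t * (Metric.ediam A + (σ + σ)) := by
            gcongr
            exacts [hσ x hx, hσ y hy]
        _ = Z := by rw [← two_mul]
    exact (ENNReal.lt_add_right (ne_top_of_le_ne_top hZt (le_self_add.trans h)) hε).trans_le h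
  obtain ⟨r, hr⟩ : ∃ r : ℝ≥0, (r : ℝ≥0∞) = Z ^ (1 / q) :=
    ⟨(Z ^ (1 / q)).toNNReal, ENNReal.coe_toNNReal (ENNReal.rpow_ne_top_of_nonneg (by positivity) hZt)⟩
  have hrq : (r : ℝ≥0∞) ^ q = Z := by
    rw [hr, ← ENNReal.rpow_mul, one_div_mul_cancel hq0.ne', ENNReal.rpow_one]
  have hr0 : r ≠ 0 := by
    rintro rfl
    rw [ENNReal.coe_zero, ENNReal.zero_rpow_of_pos hq0] at hrq
    exact (zero_le.trans_lt (hlt x₀ hx₀ x₀ hx₀)).ne hrq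
  have hgauge : ∀ x ∈ A, ∀ y ∈ A, egauge ℝ≥0 T (π x - commonPart (π x) (π y)) < r := by
    intro x hx y hy
    rw [← ENNReal.rpow_lt_rpow_iff hq0, hrq]
    exact (egauge_sub_commonPart_rpow_le ht (π y) (hfin x hx) (hmin x hx)).trans_lt
      (hlt x hx y hy)
  have h := entropyNumber_le_add_mul (n := n) (A := A) (T := T) (δ := σ) (c := 2 * r)
    (mul_ne_zero two_ne_zero hr0) (π x₀) fun x hx => by
      obtain ⟨u, hu, hxu⟩ := exists_eq_add_smul hconv hsolid (hgauge x hx x₀ hx₀)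
        (hgauge x₀ hx₀ x hx)
      exact ⟨u, hu, by rw [← hxu]; exact le_self_add.trans (hσ x hx)⟩
  rwa [ENNReal.coe_mul, hr, ENNReal.coe_ofNat] at h

/-- The contraction principle applied to the near-minimizers with `t n = c * 2 ^ (n / α)`. The
hypothesis `hu` is Young's inequality splitting the entropy bound of
`entropyNumber_le_of_near_minimizers` into a small multiple of the diameter and a sequence `u`; the
scale `c` is left free. -/
theorem chainingFunctional_le_of_young {α : ℝ} {T : Set X} (hT : Metric.ediam T ≠ ∞)
    (hconv : Convex ℝ T)
    (hsolid : LatticeOrderedAddCommGroup.IsSolid T) {q : ℝ} (hq : 1 ≤ q) {M : ℝ≥0} (hM : M ≠ 0)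
    (hest : HasLowerEstimate T q M) {κ c b S : ℝ≥0∞} {u : ℕ → ℝ≥0∞} (hκ0 : κ ≠ 0) (hκ1 : κ ≤ 1)
    (hκ : 1 + κ * 2 ^ (1 / α) ≤ 2 ^ (1 / α)) (hc0 : c ≠ 0) (hc : c ≠ ∞) (hb1 : b ≤ 1)
    (hb : 2 ^ (2 / α) * (2 * b) ≤ 1 / 2)
    (hu : ∀ (n : ℕ) z, 2 * (c * 2 ^ ((n : ℝ) / α) * z) ^ (1 / q) * entropyNumber n T ≤ b * z + u n)
    (hS0 : S ≠ 0)
    (hS : 15 * ((M : ℝ≥0∞) ^ q / c) / κ + ∑' n : ℕ, 2 ^ ((n : ℝ) / α) * u n ≤ S) :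
    chainingFunctional α T ≤
      2 * ((1 + 2 ^ (1 / α)) * Metric.ediam T + 2 ^ (2 / α) * (12 * S)) := by
  set w : ℕ → ℝ≥0∞ := fun n => 2 ^ ((n : ℝ) / α) with hw
  have hw0 : ∀ n, w n ≠ 0 := fun n => two_rpow_ne_zero _
  have hwt : ∀ n, w n ≠ ∞ := fun n => two_rpow_ne_top _
  have hq0 : 0 < q := by linarith
  have hκt : κ ≠ ∞ := ne_top_of_le_ne_top ENNReal.one_ne_top hκ1
  set B : ℝ≥0∞ := (M : ℝ≥0∞) ^ q with hB
  have hBt : B ≠ ∞ := ENNReal.rpow_ne_top_of_nonneg hq0.le ENNReal.coe_ne_top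
  have hB0 : B ≠ 0 := by simp [hB, ENNReal.rpow_eq_zero_iff, hM]
  set ε : ℕ → ℝ≥0∞ := fun n => B / 2 ^ n with hε
  have hε0 : ∀ n, ε n ≠ 0 := fun n => ENNReal.div_ne_zero.2 ⟨hB0, by simp⟩
  have hεt : ∀ n, ε n ≠ ∞ := fun n => ENNReal.div_ne_top hBt (by positivity)
  have hεsum : ∑' n, ε n ≤ 2 * B := ENNReal.tsum_le_of_sum_range_le (sum_div_two_pow_le B)
  set t : ℕ → ℝ≥0∞ := fun n => c * w n with ht
  have ht0 : ∀ n, t n ≠ 0 := fun n => mul_ne_zero hc0 (hw0 n)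
  have htt : ∀ n, t n ≠ ∞ := fun n => ENNReal.mul_ne_top hc (hwt n)
  have hfB : ∀ x ∈ T, lowerEstimateEnvelope T q x ≤ B := fun x hx =>
    lowerEstimateEnvelope_le hq hsolid hest hx
  obtain ⟨π, hπ⟩ := exists_near_minimizers (t := t) hκ1 (fun n => by
    have h1 : w (n + 1) = 2 ^ (1 / α) * w n := by exact_mod_cast two_rpow_add α n 1
    calc t n + κ * t (n + 1) = (1 + κ * 2 ^ (1 / α)) * (c * w n) := by
          simp only [ht, h1]; ring
      _ ≤ 2 ^ (1 / α) * (c * w n) := by gcongr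
      _ = t (n + 1) := by simp only [ht, h1]; ring) hε0 hBt hfB
  have hfin : ∀ n, ∀ x ∈ T, lowerEstimateEnvelope T q (π n x) ≠ ∞ := by
    intro n x hx
    refine ne_top_of_le_ne_top (ENNReal.add_ne_top.2 ⟨ne_top_of_le_ne_top hBt (hfB x hx), hεt n⟩)
      (le_self_add.trans (((hπ x hx).1 n x).trans_eq ?_))
    simp
  refine chainingFunctional_le_of_entropyNumber_le
    (s := fun n x => 3 * (edist x (π n x) + ε n / t n) + u n) hS0 hb (fun n A hA => ?_)
    fun x hx => ?_
  · rcases A.eq_empty_or_nonempty with rfl | hne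
    · rw [entropyNumber_empty]
      exact zero_le
    set σ := ⨆ x ∈ A, edist x (π n x) + ε n / t n with hσ
    have hσ' : ⨆ x ∈ A, (3 * (edist x (π n x) + ε n / t n) + u n) = 3 * σ + u n := by
      rw [← ENNReal.biSup_add hne]
      simp only [hσ, ENNReal.mul_iSup]
    rw [hσ']
    rcases eq_or_ne σ ∞ with hσt | hσt
    · rw [hσt]
      simp [ENNReal.mul_top]
    have h := entropyNumber_le_of_near_minimizers hconv hsolid hq (ht0 n) (htt n) (hε0 n)
      (fun x hx => hfin n x (hA hx)) (fun x hx => (hπ x (hA hx)).1 n)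
      (ne_top_of_le_ne_top hT (Metric.ediam_mono hA))
      (fun x hx => le_iSup₂ (f := fun x (_ : x ∈ A) => edist x (π n x) + ε n / t n) x hx) hσt n
    calc entropyNumber n A ≤ _ := h
      _ ≤ σ + (b * (Metric.ediam A + 2 * σ) + u n) := by
          gcongr
          exact hu n _
      _ = b * Metric.ediam A + (σ + b * (2 * σ) + u n) := by ring
      _ ≤ b * Metric.ediam A + (σ + 1 * (2 * σ) + u n) := by gcongr
      _ = _ := by ring
  · refine le_trans ?_ hS
    have hd : ∑' n, t n * edist x (π n x) ≤ 3 * B / κ := by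
      rw [ENNReal.le_div_iff_mul_le (Or.inl hκ0) (Or.inl hκt), mul_comm]
      calc _ ≤ B + ∑' n, ε n := (hπ x hx).2
        _ ≤ B + 2 * B := by gcongr
        _ = 3 * B := by ring
    have hε2 : ∑' n, ε n ≤ 2 * B / κ := by
      refine hεsum.trans ?_
      rw [ENNReal.le_div_iff_mul_le (Or.inl hκ0) (Or.inl hκt)]
      exact mul_le_of_le_one_right' hκ1
    have hterm : ∀ n, w n * (3 * (edist x (π n x) + ε n / t n) + u n) =
        3 * c⁻¹ * (t n * edist x (π n x)) + 3 * c⁻¹ * ε n + w n * u n := by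
      intro n
      have e1 : w n = c⁻¹ * t n := by
        rw [ht, ← mul_assoc, ENNReal.inv_mul_cancel hc0 hc, one_mul]
      have e2 : w n * (ε n / t n) = c⁻¹ * ε n := by
        rw [e1, mul_assoc, ENNReal.mul_div_cancel (ht0 n) (htt n)]
      calc _ = 3 * (w n * edist x (π n x)) + 3 * (w n * (ε n / t n)) + w n * u n := by ring
        _ = _ := by rw [e2, e1]; ring
    rw [tsum_congr hterm, ENNReal.tsum_add, ENNReal.tsum_add, ENNReal.tsum_mul_left,
      ENNReal.tsum_mul_left]
    gcongr
    calc _ ≤ 3 * c⁻¹ * (3 * B / κ) + 3 * c⁻¹ * (2 * B / κ) := by gcongr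
      _ = _ := by simp only [div_eq_mul_inv]; ring

end LowerEstimate

/-! ### The chaining bound under a lower estimate -/

section Constant

/-- `1 - 2 ^ (-1 / α)`, the relative increment of the geometric sequence `2 ^ (n / α)`. -/
noncomputable def chainingGap (α : ℝ) : ℝ≥0∞ := 1 - (2 ^ (1 / α))⁻¹

/-- The coefficient of the diameter at which the contraction principle applies. -/
noncomputable def chainingContraction (α : ℝ) : ℝ≥0∞ := (4 * 2 ^ (2 / α))⁻¹

/-- The constant, depending only on `α`, in the chaining bounds. -/
noncomputable def chainingConstant (α : ℝ) : ℝ≥0∞ :=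
  2 * ((1 + 2 ^ (1 / α)) * 2 +
    2 ^ (2 / α) * (12 * (30 / chainingContraction α / chainingGap α + 2)))

variable {α : ℝ}

theorem chainingGap_le_one : chainingGap α ≤ 1 := tsub_le_self

theorem chainingGap_ne_zero (hα : 0 < α) : chainingGap α ≠ 0 := by
  rw [chainingGap, ne_eq, tsub_eq_zero_iff_le, not_le, ENNReal.inv_lt_one]
  exact ENNReal.one_lt_rpow (by norm_num) (by positivity)

theorem one_add_chainingGap_mul_le (hα : 0 < α) :
    1 + chainingGap α * 2 ^ (1 / α) ≤ 2 ^ (1 / α) := by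
  rw [chainingGap, ENNReal.sub_mul fun _ _ => two_rpow_ne_top _, one_mul,
    ENNReal.inv_mul_cancel (two_rpow_ne_zero _) (two_rpow_ne_top _), add_tsub_cancel_of_le]
  exact ENNReal.one_le_rpow (by norm_num) (by positivity)

theorem chainingContraction_ne_zero : chainingContraction α ≠ 0 :=
  ENNReal.inv_ne_zero.2 (ENNReal.mul_ne_top (by norm_num) (two_rpow_ne_top _))

theorem chainingContraction_ne_top : chainingContraction α ≠ ∞ :=
  ENNReal.inv_ne_top.2 (mul_ne_zero (by norm_num) (two_rpow_ne_zero _))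

theorem chainingContraction_le_one (hα : 0 < α) : chainingContraction α ≤ 1 := by
  refine ENNReal.inv_le_one.2 (one_le_mul (by norm_num) ?_)
  exact ENNReal.one_le_rpow (by norm_num) (by positivity)

theorem two_rpow_mul_chainingContraction_le :
    2 ^ (2 / α) * (2 * chainingContraction α) ≤ 1 / 2 := by
  have h4 : (4 : ℝ≥0∞) = 2 * 2 := by norm_num
  have h2 : (2 : ℝ≥0∞) * 2⁻¹ = 1 := ENNReal.mul_inv_cancel two_ne_zero ENNReal.ofNat_ne_top
  have hw : (2 : ℝ≥0∞) ^ (2 / α) * (2 ^ (2 / α))⁻¹ = 1 :=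
    ENNReal.mul_inv_cancel (two_rpow_ne_zero _) (two_rpow_ne_top _)
  rw [chainingContraction, ENNReal.mul_inv (Or.inl (by norm_num)) (Or.inl (by norm_num)), h4,
    ENNReal.mul_inv (Or.inl (by norm_num)) (Or.inl (by norm_num))]
  refine le_of_eq ?_
  calc _ = (2 * 2⁻¹) * ((2 : ℝ≥0∞) ^ (2 / α) * (2 ^ (2 / α))⁻¹) * 2⁻¹ := by ring
    _ = _ := by rw [h2, hw]; simp

theorem chainingConstant_ne_zero : chainingConstant α ≠ 0 := by
  simp [chainingConstant]

theorem chainingConstant_ne_top (hα : 0 < α) : chainingConstant α ≠ ∞ := by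
  have h1 : (30 : ℝ≥0∞) / chainingContraction α / chainingGap α ≠ ∞ :=
    ENNReal.div_ne_top (ENNReal.div_ne_top (by norm_num) chainingContraction_ne_zero)
      (chainingGap_ne_zero hα)
  have h2 := two_rpow_ne_top (1 / α)
  have h3 := two_rpow_ne_top (2 / α)
  rw [chainingConstant]
  refine ENNReal.mul_ne_top (by norm_num) (ENNReal.add_ne_top.2
    ⟨ENNReal.mul_ne_top (ENNReal.add_ne_top.2 ⟨by norm_num, h2⟩) (by norm_num),
    ENNReal.mul_ne_top h3 (ENNReal.mul_ne_top (by norm_num)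
      (ENNReal.add_ne_top.2 ⟨h1, by norm_num⟩))⟩)

end Constant

section LowerEstimate

variable {X : Type*} [NormedAddCommGroup X] [NormedSpace ℝ X] [Lattice X] [IsOrderedAddMonoid X]
  [HasSolidNorm X]

/-- Already the one-element families force `1 ≤ M`, unless `T` has at most one point. -/
theorem one_le_of_hasLowerEstimate {T : Set X} (hT : Bornology.IsBounded T)
    (hsolid : LatticeOrderedAddCommGroup.IsSolid T) {q : ℝ} (hq : 1 ≤ q) {M : ℝ≥0}
    (hest : HasLowerEstimate T q M) (hdiam : Metric.ediam T ≠ 0) : 1 ≤ M := by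
  obtain ⟨x, hx, hx0⟩ : ∃ x ∈ T, x ≠ 0 := by
    by_contra! h
    exact hdiam (Metric.ediam_subsingleton fun x hx y hy => (h x hx).trans (h y hy).symm)
  have hq0 : 0 < q := by linarith
  have hmem : |x| ∈ T := hsolid hx (by simp)
  have h1 := hest 1 le_rfl fun _ => |x|
  simp only [Fin.sum_univ_one, abs_abs] at h1
  rw [← ENNReal.rpow_mul, mul_one_div_cancel hq0.ne', ENNReal.rpow_one] at h1
  have htop : egauge ℝ≥0 T |x| ≠ ∞ :=
    ne_top_of_le_ne_top ENNReal.one_ne_top (egauge_le_one_of_mem hmem)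
  have hpos : egauge ℝ≥0 T |x| ≠ 0 := by
    obtain ⟨R, hR0, hR⟩ := hT.exists_pos_norm_le
    have h2 : ENNReal.ofReal (‖x‖ / R) ≤ egauge ℝ≥0 T |x| := by
      refine le_egauge_iff.2 fun c hc => ?_
      obtain ⟨y, hy, hyx⟩ := hc
      change c • y = |x| at hyx
      have h3 : ‖x‖ = c * ‖y‖ := by
        rw [← norm_abs_eq_norm x, ← hyx, NNReal.smul_def, norm_smul, Real.norm_eq_abs,
          NNReal.abs_eq]
      refine ENNReal.ofReal_le_of_le_toReal ?_
      change ‖x‖ / R ≤ c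
      rw [div_le_iff₀ hR0, h3]
      exact mul_le_mul_of_nonneg_left (hR y hy) c.2
    refine ((ENNReal.ofReal_pos.2 ?_).trans_le h2).ne'
    exact div_pos (norm_pos_iff.2 hx0) hR0
  by_contra! hM
  refine (ENNReal.mul_lt_of_lt_div ?_).not_ge h1
  rw [ENNReal.div_self hpos htop]
  exact_mod_cast hM

/-- The bound by `M * E`, at the scale `c = b * M ^ (q - 1) / (2 * E)` which balances the
interpolation term `M ^ q / c` against the sum of the remainders `u` in Young's inequality. The
degenerate values of `E` and `M` are excluded in the hypothesis on `u`. -/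
theorem chainingFunctional_le_of_weights {α : ℝ} (hα : 0 < α) {T : Set X}
    (hT : Bornology.IsBounded T) (hconv : Convex ℝ T)
    (hsolid : LatticeOrderedAddCommGroup.IsSolid T) {q : ℝ} (hq : 1 ≤ q) {M : ℝ≥0}
    (hest : HasLowerEstimate T q M) {E : ℝ≥0∞} (hE : entropyNumber 0 T ≤ E)
    (hu : E ≠ 0 → E ≠ ∞ → M ≠ 0 → ∃ u : ℕ → ℝ≥0∞,
      (∀ (n : ℕ) z, 2 * (chainingContraction α * (M : ℝ≥0∞) ^ (q - 1) / (2 * E) *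
        2 ^ ((n : ℝ) / α) * z) ^ (1 / q) * entropyNumber n T ≤ chainingContraction α * z + u n) ∧
      ∑' n : ℕ, 2 ^ ((n : ℝ) / α) * u n ≤ 2 * E * M) :
    chainingFunctional α T ≤ chainingConstant α * M * E := by
  rcases eq_or_ne (Metric.ediam T) 0 with hd | hd
  · rw [chainingFunctional_eq_zero hd]
    exact zero_le
  have hM1 : 1 ≤ M := one_le_of_hasLowerEstimate hT hsolid hq hest hd
  have hM : M ≠ 0 := (zero_lt_one.trans_le hM1).ne'
  have hM' : (M : ℝ≥0∞) ≠ 0 := ENNReal.coe_ne_zero.2 hM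
  have hdE : Metric.ediam T ≤ 2 * E :=
    (ediam_le_two_mul_entropyNumber_zero T).trans (by gcongr)
  have hE0 : E ≠ 0 := by
    rintro rfl
    exact hd (le_antisymm (by simpa using hdE) zero_le)
  rcases eq_or_ne E ∞ with rfl | hEt
  · rw [ENNReal.mul_top (mul_ne_zero chainingConstant_ne_zero hM')]
    exact le_top
  obtain ⟨u, hu, husum⟩ := hu hE0 hEt hM
  set b := chainingContraction α with hb
  have hb0 : b ≠ 0 := chainingContraction_ne_zero
  have hbt : b ≠ ∞ := chainingContraction_ne_top
  have hMq0 : (M : ℝ≥0∞) ^ (q - 1) ≠ 0 := by simp [ENNReal.rpow_eq_zero_iff, hM]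
  have hMqt : (M : ℝ≥0∞) ^ (q - 1) ≠ ∞ :=
    ENNReal.rpow_ne_top_of_nonneg (by linarith) ENNReal.coe_ne_top
  have h2E0 : 2 * E ≠ 0 := mul_ne_zero two_ne_zero hE0
  have h2Et : 2 * E ≠ ∞ := ENNReal.mul_ne_top ENNReal.ofNat_ne_top hEt
  have hquot : (M : ℝ≥0∞) ^ q / (b * (M : ℝ≥0∞) ^ (q - 1) / (2 * E)) = 2 * E * M / b := by
    have h1 : (M : ℝ≥0∞) ^ q = (M : ℝ≥0∞) ^ (q - 1) * M := by
      conv_rhs => rw [← ENNReal.rpow_one (M : ℝ≥0∞), ← ENNReal.rpow_mul]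
      rw [← ENNReal.rpow_add _ _ hM' ENNReal.coe_ne_top]
      congr 1
      ring
    rw [h1, div_eq_mul_inv, ENNReal.inv_div (Or.inl h2Et) (Or.inl h2E0), div_eq_mul_inv,
      ENNReal.mul_inv (Or.inl hb0) (Or.inl hbt), div_eq_mul_inv]
    calc _ = ((M : ℝ≥0∞) ^ (q - 1) * ((M : ℝ≥0∞) ^ (q - 1))⁻¹) * (2 * E * M * b⁻¹) := by ring
      _ = _ := by rw [ENNReal.mul_inv_cancel hMq0 hMqt, one_mul]
  refine (chainingFunctional_le_of_young
    (S := (30 / b / chainingGap α + 2) * (M * E)) hT.ediam_ne_top hconv hsolid hq hM hest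
    (chainingGap_ne_zero hα) chainingGap_le_one (one_add_chainingGap_mul_le hα)
    (ENNReal.div_ne_zero.2 ⟨mul_ne_zero hb0 hMq0, h2Et⟩)
    (ENNReal.div_ne_top (ENNReal.mul_ne_top hbt hMqt) h2E0) (chainingContraction_le_one hα)
    two_rpow_mul_chainingContraction_le hu ?_ ?_).trans ?_
  · exact mul_ne_zero (by simp) (mul_ne_zero hM' hE0)
  · rw [hquot]
    calc _ ≤ 15 * (2 * E * M / b) / chainingGap α + 2 * E * M := by gcongr
      _ = _ := by simp only [div_eq_mul_inv]; ring
  · have h1 : Metric.ediam T ≤ 2 * (M * E) := by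
      refine hdE.trans ?_
      gcongr
      exact le_mul_of_one_le_left' (by exact_mod_cast hM1)
    calc _ ≤ 2 * ((1 + 2 ^ (1 / α)) * (2 * (M * E)) +
          2 ^ (2 / α) * (12 * ((30 / b / chainingGap α + 2) * (M * E)))) := by gcongr
      _ = _ := by rw [chainingConstant, ← hb]; ring

theorem chainingFunctional_le_of_lower_one_estimate {α : ℝ} (hα : 0 < α) {T : Set X}
    (hT : Bornology.IsBounded T) (hconv : Convex ℝ T)
    (hsolid : LatticeOrderedAddCommGroup.IsSolid T) {M : ℝ≥0} (hest : HasLowerEstimate T 1 M) :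
    chainingFunctional α T ≤ chainingConstant α * M *
      ⨆ n : ℕ, (2 : ℝ≥0∞) ^ ((n : ℝ) / α) * entropyNumber n T := by
  have hle := le_iSup fun n : ℕ => (2 : ℝ≥0∞) ^ ((n : ℝ) / α) * entropyNumber n T
  refine chainingFunctional_le_of_weights hα hT hconv hsolid le_rfl hest
    (by simpa using hle 0) fun hE0 hEt _ => ⟨fun _ => 0, fun n z => ?_, by simp⟩
  set E := ⨆ n : ℕ, (2 : ℝ≥0∞) ^ ((n : ℝ) / α) * entropyNumber n T
  have h2 : (2 * E) * (2 * E)⁻¹ = 1 := ENNReal.mul_inv_cancel (mul_ne_zero two_ne_zero hE0)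
    (ENNReal.mul_ne_top ENNReal.ofNat_ne_top hEt)
  rw [sub_self, ENNReal.rpow_zero, mul_one, div_one, ENNReal.rpow_one, add_zero, div_eq_mul_inv]
  calc _ = chainingContraction α * z * (2 * (2 ^ ((n : ℝ) / α) * entropyNumber n T)) *
        (2 * E)⁻¹ := by ring
    _ ≤ chainingContraction α * z * (2 * E) * (2 * E)⁻¹ := by
        gcongr
        exact hle n
    _ = _ := by rw [mul_assoc, h2, mul_one]

theorem chainingFunctional_le_of_lower_estimate {α : ℝ} (hα : 0 < α) {T : Set X}
    (hT : Bornology.IsBounded T) (hconv : Convex ℝ T)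
    (hsolid : LatticeOrderedAddCommGroup.IsSolid T) {q : ℝ} (hq : 1 < q) {M : ℝ≥0}
    (hest : HasLowerEstimate T q M) :
    chainingFunctional α T ≤ chainingConstant α * M *
      (∑' n : ℕ, ((2 : ℝ≥0∞) ^ ((n : ℝ) / α) * entropyNumber n T) ^ (q / (q - 1)))
        ^ ((q - 1) / q) := by
  have hq0 : 0 < q := by linarith
  have hq1 : 0 < q - 1 := by linarith
  have hconj : q.HolderConjugate (q / (q - 1)) := Real.HolderConjugate.conjExponent hq
  have hpr : (q - 1) / q * (q / (q - 1)) = 1 := by field_simp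
  set p := q / (q - 1) with hp
  have hp0 : 0 < p := by positivity
  set Q := ∑' n : ℕ, ((2 : ℝ≥0∞) ^ ((n : ℝ) / α) * entropyNumber n T) ^ p with hQ
  have hEp : (Q ^ ((q - 1) / q)) ^ p = Q := by
    rw [← ENNReal.rpow_mul, hpr, ENNReal.rpow_one]
  refine chainingFunctional_le_of_weights hα hT hconv hsolid hq.le hest ?_ fun hE0 hEt hM => ?_
  · rw [← ENNReal.rpow_le_rpow_iff hp0, hEp, hQ]
    refine le_trans (le_of_eq ?_) (ENNReal.le_tsum 0)
    simp
  set E := Q ^ ((q - 1) / q)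
  set b := chainingContraction α
  have hb0 : b ≠ 0 := chainingContraction_ne_zero
  have hbt : b ≠ ∞ := chainingContraction_ne_top
  have hG0 : 2 * E ≠ 0 := mul_ne_zero two_ne_zero hE0
  have hGt : 2 * E ≠ ∞ := ENNReal.mul_ne_top ENNReal.ofNat_ne_top hEt
  set m := (M : ℝ≥0∞) ^ (q - 1) / (2 * E) with hm
  refine ⟨fun n => (2 * (m * 2 ^ ((n : ℝ) / α)) ^ (1 / q) * entropyNumber n T) ^ p,
    fun n z => ?_, ?_⟩
  · have hsplit : 2 * (b * (M : ℝ≥0∞) ^ (q - 1) / (2 * E) * 2 ^ ((n : ℝ) / α) * z) ^ (1 / q) *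
        entropyNumber n T =
        (b * z) ^ (1 / q) * (2 * (m * 2 ^ ((n : ℝ) / α)) ^ (1 / q) * entropyNumber n T) := by
      rw [show b * (M : ℝ≥0∞) ^ (q - 1) / (2 * E) * 2 ^ ((n : ℝ) / α) * z =
        (b * z) * (m * 2 ^ ((n : ℝ) / α)) by simp only [hm, div_eq_mul_inv]; ring,
        ENNReal.mul_rpow_of_nonneg _ _ (by positivity)]
      ring
    rw [hsplit]
    refine (ENNReal.young_inequality _ _ hconj).trans (add_le_add ?_ ?_)
    · rw [← ENNReal.rpow_mul, one_div_mul_cancel hq0.ne', ENNReal.rpow_one]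
      exact ENNReal.div_le_of_le_mul (le_mul_of_one_le_right' (by simpa using hq.le))
    · exact ENNReal.div_le_of_le_mul (le_mul_of_one_le_right' (by simpa using hconj.symm.lt.le))
  -- The powers of `2 ^ (n / α)` combine because `1 + p / q = p`.
  · have hpq : 1 + 1 / q * p = p := by
      rw [hp]
      field_simp
      ring
    have hterm : ∀ n : ℕ, (2 : ℝ≥0∞) ^ ((n : ℝ) / α) *
        (2 * (m * 2 ^ ((n : ℝ) / α)) ^ (1 / q) * entropyNumber n T) ^ p =
        (2 * m ^ (1 / q)) ^ p * (2 ^ ((n : ℝ) / α) * entropyNumber n T) ^ p := by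
      intro n
      set w : ℝ≥0∞ := 2 ^ ((n : ℝ) / α) with hw
      have hw0 : w ≠ 0 := two_rpow_ne_zero _
      have hwt : w ≠ ∞ := two_rpow_ne_top _
      have h1 : w * (w ^ (1 / q)) ^ p = w ^ p := by
        rw [← ENNReal.rpow_mul]
        nth_rw 1 [← ENNReal.rpow_one w]
        rw [← ENNReal.rpow_add _ _ hw0 hwt, hpq]
      rw [ENNReal.mul_rpow_of_nonneg m w (by positivity : 0 ≤ 1 / q),
        show 2 * (m ^ (1 / q) * w ^ (1 / q)) * entropyNumber n T =
          (2 * m ^ (1 / q)) * (w ^ (1 / q) * entropyNumber n T) by ring,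
        ENNReal.mul_rpow_of_nonneg _ _ hp0.le, ENNReal.mul_rpow_of_nonneg _ _ hp0.le,
        ENNReal.mul_rpow_of_nonneg _ _ hp0.le, ENNReal.mul_rpow_of_nonneg _ _ hp0.le, ← h1]
      ring
    rw [tsum_congr hterm, ENNReal.tsum_mul_left, ← hQ, ← hEp,
      ← ENNReal.mul_rpow_of_nonneg _ _ hp0.le]
    have hbase : 2 * m ^ (1 / q) * E = (2 * E * M) ^ ((q - 1) / q) := by
      have h1 : m ^ (1 / q) = (M : ℝ≥0∞) ^ ((q - 1) / q) / (2 * E) ^ (1 / q) := by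
        rw [hm, ENNReal.div_rpow_of_nonneg _ _ (by positivity), ← ENNReal.rpow_mul, mul_one_div]
      have h2 : 2 * E = (2 * E) ^ ((q - 1) / q) * (2 * E) ^ (1 / q) := by
        rw [← ENNReal.rpow_add _ _ hG0 hGt, show (q - 1) / q + 1 / q = 1 by field_simp; ring,
          ENNReal.rpow_one]
      have h3 : (2 * E) ^ (1 / q) * ((2 * E) ^ (1 / q))⁻¹ = 1 :=
        ENNReal.mul_inv_cancel (by simp [ENNReal.rpow_eq_zero_iff, hG0, hGt])
          (ENNReal.rpow_ne_top_of_nonneg (by positivity) hGt)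
      rw [h1, ENNReal.mul_rpow_of_nonneg (2 * E) _ (by positivity : 0 ≤ (q - 1) / q)]
      calc _ = (2 * E) * ((M : ℝ≥0∞) ^ ((q - 1) / q) * ((2 * E) ^ (1 / q))⁻¹) := by
            rw [div_eq_mul_inv]; ring
        _ = ((2 * E) ^ ((q - 1) / q) * (2 * E) ^ (1 / q)) *
            ((M : ℝ≥0∞) ^ ((q - 1) / q) * ((2 * E) ^ (1 / q))⁻¹) := by rw [← h2]
        _ = ((2 * E) ^ ((q - 1) / q) * (M : ℝ≥0∞) ^ ((q - 1) / q)) *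
            ((2 * E) ^ (1 / q) * ((2 * E) ^ (1 / q))⁻¹) := by ring
        _ = _ := by rw [h3, mul_one]
    rw [hbase, ← ENNReal.rpow_mul, hpr, ENNReal.rpow_one]

end LowerEstimate

/-! ### Sudakov's lower bound and unconditional bases -/

section Sudakov

variable {X : Type*} [PseudoEMetricSpace X]

/-- Choosing one point in each cell of the `n`-th partition gives a net for `entropyNumber n T`. -/
theorem two_rpow_mul_entropyNumber_le_chainingFunctional (α : ℝ) (T : Set X) (n : ℕ) :
    (2 : ℝ≥0∞) ^ ((n : ℝ) / α) * entropyNumber n T ≤ chainingFunctional α T := by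
  refine le_iInf fun 𝒜 => ?_
  have hfin : (𝒜.parts n).Finite := Set.finite_of_encard_le_coe (𝒜.card_lt n).le
  rcases T.eq_empty_or_nonempty with rfl | ⟨x₀, -⟩
  · rw [entropyNumber_empty, mul_zero]
    exact zero_le
  have : Nonempty X := ⟨x₀⟩
  choose! p hp using 𝒜.nonempty_of_mem n
  classical
  have hcard : (hfin.toFinset.image p).card < 2 ^ 2 ^ n := by
    refine Finset.card_image_le.trans_lt ?_
    have := 𝒜.card_lt n
    rw [hfin.encard_eq_coe_toFinset_card] at this
    exact_mod_cast this
  have hle : entropyNumber n T ≤ ⨆ x ∈ T, Metric.ediam (𝒜.cell n x) := by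
    refine iInf₂_le_of_le _ hcard (iSup₂_mono fun x hx => ?_)
    obtain ⟨A, ⟨hA, hxA⟩, -⟩ := 𝒜.existsUnique_mem n x hx
    have hsub : A ⊆ 𝒜.cell n x := Set.subset_sUnion_of_mem ⟨hA, hxA⟩
    refine (Metric.infEDist_le_edist_of_mem (y := p A) ?_).trans
      (Metric.edist_le_ediam_of_mem (hsub hxA) (hsub (hp A hA)))
    exact Finset.mem_coe.2 (Finset.mem_image_of_mem _ (hfin.mem_toFinset.2 hA))
  calc _ ≤ (2 : ℝ≥0∞) ^ ((n : ℝ) / α) * ⨆ x ∈ T, Metric.ediam (𝒜.cell n x) := by gcongr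
    _ = ⨆ x ∈ T, (2 : ℝ≥0∞) ^ ((n : ℝ) / α) * Metric.ediam (𝒜.cell n x) := by
        simp only [ENNReal.mul_iSup]
    _ ≤ _ := iSup₂_mono fun x _ => ENNReal.le_tsum n

end Sudakov

section Unconditional

variable {d : ℕ} {X : Type*} [NormedAddCommGroup X] [NormedSpace ℝ X]

/-- The coordinatewise order of a basis. It is not an instance, since it depends on the basis. -/
@[reducible]
noncomputable def coordinateLattice (b : Module.Basis (Fin d) ℝ X) : Lattice X where
  toPartialOrder := PartialOrder.lift b.equivFun b.equivFun.injective
  sup x y := b.equivFun.symm (b.equivFun x ⊔ b.equivFun y)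
  inf x y := b.equivFun.symm (b.equivFun x ⊓ b.equivFun y)
  le_sup_left x y := by
    change b.equivFun x ≤ b.equivFun (b.equivFun.symm _)
    rw [LinearEquiv.apply_symm_apply]
    exact le_sup_left
  le_sup_right x y := by
    change b.equivFun y ≤ b.equivFun (b.equivFun.symm _)
    rw [LinearEquiv.apply_symm_apply]
    exact le_sup_right
  sup_le x y z hx hy := by
    change b.equivFun (b.equivFun.symm _) ≤ b.equivFun z
    rw [LinearEquiv.apply_symm_apply]
    exact sup_le hx hy
  inf_le_left x y := by
    change b.equivFun (b.equivFun.symm _) ≤ b.equivFun x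
    rw [LinearEquiv.apply_symm_apply]
    exact inf_le_left
  inf_le_right x y := by
    change b.equivFun (b.equivFun.symm _) ≤ b.equivFun y
    rw [LinearEquiv.apply_symm_apply]
    exact inf_le_right
  le_inf x y z hx hy := by
    change b.equivFun x ≤ b.equivFun (b.equivFun.symm _)
    rw [LinearEquiv.apply_symm_apply]
    exact le_inf hx hy

theorem coordinateLattice_le_iff (b : Module.Basis (Fin d) ℝ X) (x y : X) :
    (coordinateLattice b).le x y ↔ ∀ i, b.repr x i ≤ b.repr y i := Iff.rfl

theorem coordinateLattice_isOrderedAddMonoid (b : Module.Basis (Fin d) ℝ X) :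
    letI := coordinateLattice b
    IsOrderedAddMonoid X := by
  let := coordinateLattice b
  refine { add_le_add_left := fun x y h z => ?_ }
  rw [coordinateLattice_le_iff] at h ⊢
  intro i
  simpa using h i

theorem repr_coordinateLattice_abs (b : Module.Basis (Fin d) ℝ X) (x : X) (i : Fin d) :
    letI := coordinateLattice b
    b.repr |x| i = |b.repr x i| := by
  let := coordinateLattice b
  have h : |x| = b.equivFun.symm (b.equivFun x ⊔ b.equivFun (-x)) := rfl
  change b.equivFun |x| i = |b.equivFun x i|
  rw [h, LinearEquiv.apply_symm_apply, map_neg]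
  rfl

theorem coordinateLattice_abs_le_abs_iff (b : Module.Basis (Fin d) ℝ X) (x y : X) :
    letI := coordinateLattice b
    |x| ≤ |y| ↔ ∀ i, |b.repr x i| ≤ |b.repr y i| := by
  let := coordinateLattice b
  simp only [← repr_coordinateLattice_abs]
  exact coordinateLattice_le_iff b _ _

/-- Shrinking one coordinate is a convex combination of the identity and of a sign change. -/
theorem norm_sum_update_smul_le {b : Module.Basis (Fin d) ℝ X} (hb : IsUnconditionalBasis b)
    (c : Fin d → ℝ) (i : Fin d) {a : ℝ} (ha : |a| ≤ |c i|) :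
    ‖∑ j, Function.update c i a j • b j‖ ≤ ‖∑ j, c j • b j‖ := by
  set ε : Fin d → ℝ := Function.update 1 i (-1) with hε
  have hflip := hb ε (fun j => by
    rcases eq_or_ne j i with rfl | h
    · simp [hε]
    · simp [hε, h]) c
  obtain ⟨s, hs0, hs1, has⟩ : ∃ s : ℝ, 0 ≤ s ∧ s ≤ 1 ∧ a = (1 - s) * c i + s * (-c i) := by
    rcases eq_or_ne (c i) 0 with h0 | h0
    · refine ⟨0, le_rfl, zero_le_one, ?_⟩
      rw [h0, abs_zero, abs_nonpos_iff] at ha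
      simp [ha, h0]
    · have h1 : |a / c i| ≤ 1 := by
        rw [abs_div]
        exact div_le_one_of_le₀ ha (abs_nonneg _)
      obtain ⟨h2, h3⟩ := abs_le.1 h1
      refine ⟨(1 - a / c i) / 2, by linarith, by linarith, ?_⟩
      field_simp
      ring
  have hcomb : ∑ j, Function.update c i a j • b j =
      (1 - s) • ∑ j, c j • b j + s • ∑ j, (ε j * c j) • b j := by
    rw [Finset.smul_sum, Finset.smul_sum, ← Finset.sum_add_distrib]
    refine Finset.sum_congr rfl fun j _ => ?_
    rw [smul_smul, smul_smul, ← add_smul]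
    congr 1
    rcases eq_or_ne j i with rfl | h
    · simp [hε, has]
    · simp only [hε, Function.update_of_ne h, Pi.one_apply]
      ring
  rw [hcomb]
  refine (norm_add_le _ _).trans_eq ?_
  rw [norm_smul, norm_smul, hflip, Real.norm_of_nonneg hs0, Real.norm_of_nonneg (by linarith)]
  ring

theorem norm_le_norm_of_abs_repr_le {b : Module.Basis (Fin d) ℝ X} (hb : IsUnconditionalBasis b)
    {x y : X} (h : ∀ i, |b.repr x i| ≤ |b.repr y i|) : ‖x‖ ≤ ‖y‖ := by
  have key : ∀ s : Finset (Fin d),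
      ‖∑ j, (s.piecewise (b.repr x) (b.repr y)) j • b j‖ ≤ ‖∑ j, b.repr y j • b j‖ := by
    intro s
    induction s using Finset.induction_on with
    | empty => simp
    | insert i s hi ih =>
      rw [Finset.piecewise_insert]
      refine (norm_sum_update_smul_le hb _ i ?_).trans ih
      rw [Finset.piecewise_eq_of_notMem _ _ _ hi]
      exact h i
  simpa [b.sum_repr] using key Finset.univ

theorem coordinateLattice_hasSolidNorm {b : Module.Basis (Fin d) ℝ X}
    (hb : IsUnconditionalBasis b) :
    letI := coordinateLattice b
    HasSolidNorm X := by
  let := coordinateLattice b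
  exact ⟨fun x y h => norm_le_norm_of_abs_repr_le hb ((coordinateLattice_abs_le_abs_iff b x y).1 h)⟩

theorem l1Ball_isSolid (b : Module.Basis (Fin d) ℝ X) :
    letI := coordinateLattice b
    LatticeOrderedAddCommGroup.IsSolid (l1Ball b) := by
  let := coordinateLattice b
  intro x hx y hy
  exact (Finset.sum_le_sum fun i _ => (coordinateLattice_abs_le_abs_iff b y x).1 hy i).trans hx

theorem l1Ball_convex (b : Module.Basis (Fin d) ℝ X) : Convex ℝ (l1Ball b) := by
  intro x hx y hy s t hs ht hst
  change ∑ i, |b.repr (s • x + t • y) i| ≤ 1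
  calc ∑ i, |b.repr (s • x + t • y) i|
      ≤ ∑ i, (s * |b.repr x i| + t * |b.repr y i|) := by
        refine Finset.sum_le_sum fun i _ => ?_
        simp only [map_add, map_smul, Finsupp.add_apply, Finsupp.smul_apply, smul_eq_mul]
        refine (abs_add_le _ _).trans_eq ?_
        rw [abs_mul, abs_mul, abs_of_nonneg hs, abs_of_nonneg ht]
    _ = s * ∑ i, |b.repr x i| + t * ∑ i, |b.repr y i| := by
        rw [Finset.sum_add_distrib, Finset.mul_sum, Finset.mul_sum]
    _ ≤ s * 1 + t * 1 := add_le_add (mul_le_mul_of_nonneg_left hx hs)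
        (mul_le_mul_of_nonneg_left hy ht)
    _ = 1 := by linarith

theorem l1Ball_isBounded (b : Module.Basis (Fin d) ℝ X) : Bornology.IsBounded (l1Ball b) := by
  refine isBounded_iff_forall_norm_le.2 ⟨∑ i, ‖b i‖, fun x hx => ?_⟩
  rw [← b.sum_repr x]
  refine norm_sum_le_of_le _ fun i _ => ?_
  rw [norm_smul]
  refine mul_le_of_le_one_left (norm_nonneg _) (le_trans ?_ hx)
  exact Finset.single_le_sum (f := fun i => |b.repr x i|) (fun i _ => abs_nonneg _)
    (Finset.mem_univ i)

theorem egauge_l1Ball_le (b : Module.Basis (Fin d) ℝ X) (x : X) :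
    egauge ℝ≥0 (l1Ball b) x ≤ ENNReal.ofReal (∑ i, |b.repr x i|) := by
  set r := ∑ i, |b.repr x i| with hr
  have hr0 : 0 ≤ r := Finset.sum_nonneg fun i _ => abs_nonneg _
  refine egauge_le_of_mem_smul (c := r.toNNReal) ?_
  refine ⟨r⁻¹ • x, ?_, ?_⟩
  · change ∑ i, |b.repr (r⁻¹ • x) i| ≤ 1
    simp only [map_smul, Finsupp.smul_apply, smul_eq_mul, abs_mul, ← Finset.mul_sum, ← hr,
      abs_of_nonneg (inv_nonneg.2 hr0)]
    exact inv_mul_le_one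
  · change r.toNNReal • r⁻¹ • x = x
    rw [NNReal.smul_def, Real.coe_toNNReal r hr0, smul_smul]
    rcases eq_or_ne r 0 with h | h
    · have hx : x = 0 := by
        rw [hr, Finset.sum_eq_zero_iff_of_nonneg fun i _ => abs_nonneg _] at h
        exact b.ext_elem fun i => by simpa using h i (Finset.mem_univ i)
      simp [hx]
    · rw [mul_inv_cancel₀ h, one_smul]

theorem le_egauge_l1Ball (b : Module.Basis (Fin d) ℝ X) (x : X) :
    ENNReal.ofReal (∑ i, |b.repr x i|) ≤ egauge ℝ≥0 (l1Ball b) x := by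
  refine le_egauge_iff.2 fun c hc => ?_
  obtain ⟨y, hy, rfl⟩ := hc
  refine ENNReal.ofReal_le_of_le_toReal ?_
  change ∑ i, |b.repr ((c : ℝ) • y) i| ≤ c
  simp only [map_smul, Finsupp.smul_apply, smul_eq_mul, abs_mul, ← Finset.mul_sum, NNReal.abs_eq]
  exact mul_le_of_le_one_right c.2 hy

/-- The gauge of the `ℓ₁`-ball is the `ℓ₁`-norm, which is additive on nonnegative vectors. -/
theorem l1Ball_hasLowerEstimate (b : Module.Basis (Fin d) ℝ X) :
    letI := coordinateLattice b
    HasLowerEstimate (l1Ball b) 1 1 := by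
  let := coordinateLattice b
  intro n _ x
  simp only [ENNReal.rpow_one, div_one, ENNReal.coe_one, one_mul]
  refine le_trans ?_ (le_egauge_l1Ball b _)
  refine (Finset.sum_le_sum fun i _ => egauge_l1Ball_le b (x i)).trans_eq ?_
  rw [← ENNReal.ofReal_sum_of_nonneg fun i _ => Finset.sum_nonneg fun j _ => abs_nonneg _]
  congr 1
  rw [Finset.sum_comm]
  refine Finset.sum_congr rfl fun j _ => ?_
  simp only [map_sum, Finsupp.finsetSum_apply, repr_coordinateLattice_abs]
  rw [abs_of_nonneg (Finset.sum_nonneg fun i _ => abs_nonneg _)]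

end Unconditional

theorem theorem5p3 (α : ℝ) (hα : 0 < α) :
    ∃ C : ℝ≥0,
      -- solid compact convex sets with a lower `q`-estimate
      (∀ (X : Type*) [NormedAddCommGroup X] [NormedSpace ℝ X] [CompleteSpace X]
          [Lattice X] [IsOrderedAddMonoid X] [IsOrderedModule ℝ X] [HasSolidNorm X]
          (T : Set X) (q : ℝ) (M : ℝ≥0),
          IsCompact T → Convex ℝ T → LatticeOrderedAddCommGroup.IsSolid T →
          1 ≤ q → HasLowerEstimate T q M →
          (1 < q → chainingFunctional α T ≤
            C * M * (∑' n : ℕ, ((2 : ℝ≥0∞) ^ ((n : ℝ) / α) * entropyNumber n T) ^ (q / (q - 1)))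
              ^ ((q - 1) / q)) ∧
          (q = 1 → chainingFunctional α T ≤
            C * M * ⨆ n : ℕ, (2 : ℝ≥0∞) ^ ((n : ℝ) / α) * entropyNumber n T)) ∧
      -- Sudakov's lower bound is sharp for the `ℓ₁`-ball under an unconditional norm
      (∀ (d : ℕ) (X : Type*) [NormedAddCommGroup X] [NormedSpace ℝ X]
          (b : Module.Basis (Fin d) ℝ X), IsUnconditionalBasis b →
          (⨆ n : ℕ, (2 : ℝ≥0∞) ^ ((n : ℝ) / α) * entropyNumber n (l1Ball b))
              ≤ chainingFunctional α (l1Ball b) ∧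
          chainingFunctional α (l1Ball b) ≤
            C * ⨆ n : ℕ, (2 : ℝ≥0∞) ^ ((n : ℝ) / α) * entropyNumber n (l1Ball b)) := by
  have hC : ((chainingConstant α).toNNReal : ℝ≥0∞) = chainingConstant α :=
    ENNReal.coe_toNNReal (chainingConstant_ne_top hα)
  refine ⟨(chainingConstant α).toNNReal, ?_, ?_⟩
  · intro X _ _ _ _ _ _ _ T q M hT hconv hsolid _ hest
    rw [hC]
    refine ⟨fun hq => chainingFunctional_le_of_lower_estimate hα hT.isBounded hconv hsolid hq hest,
      ?_⟩
    rintro rfl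
    exact chainingFunctional_le_of_lower_one_estimate hα hT.isBounded hconv hsolid hest
  · intro d X _ _ b hb
    refine ⟨iSup_le fun n => two_rpow_mul_entropyNumber_le_chainingFunctional α _ n, ?_⟩
    let := coordinateLattice b
    have := coordinateLattice_isOrderedAddMonoid b
    have := coordinateLattice_hasSolidNorm hb
    have h := chainingFunctional_le_of_lower_one_estimate hα (l1Ball_isBounded b) (l1Ball_convex b)
      (l1Ball_isSolid b) (l1Ball_hasLowerEstimate b)
    rwa [ENNReal.coe_one, mul_one, ← hC] at h
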